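/- Let $g:[0,1]\to[0,\infty)$ be piecewise $C^2$ on $[0,1]$: $[0,1]$ can be partitioned into finitely many subintervals on whose interiors $g$ is $C^2$, and $g,g',g''$ have finite one-sided limits at all the endpoints of these subintervals. Assume that for some $\varepsilon>0$ we have $g(x)\ge\varepsilon$ for all $x\in[1-\varepsilon,1]\cap[0,1]$. Put $$C(\theta)=\int_0^1(e^{\theta x}-1)\,g(x)\,dx\qquad(\theta\in\mathbb R),$$ and let $T$ be a real random variable with $\log \mathbb E\,e^{\theta T}=C(\theta)$ for all real $\theta$. Then the distribution of $T$ is the sum of an atom at $0$ and an absolutely continuous part with a (defective) density $f\ge 0$ that can be chosen continuous on $(1,\infty)$; let $f$ be such a version. For every $u>0$ there is a unique real $\beta=\beta(u)$ with $C'(\beta)=u$; let $\sigma_\beta=\sqrt{C''(\beta)}$. Then, as $u\to\infty$, $$f(u)=\frac{e^{C(\beta)-u\beta}}{\sqrt{2\pi}\,\sigma_\beta}\left(1+O\left(\frac1u\right)\right),$$ $$\mathbb P(T\ge u)=\frac1\beta\,\frac{e^{C(\beta)-u\beta}}{\sqrt{2\pi}\,\sigma_\beta}\left(1+O\left(\frac1{\sqrt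 u}\right)\right),$$ and hence $$\mathbb P(T\ge u)=\frac{f(u)}{\beta}\left(1+O\left(\frac1{\sqrt u}\right)\right).$$ -/

import Mathlib

open MeasureTheory ProbabilityTheory Filter Topology Set Asymptotics

/-- `g` is piecewise `C^k` on `[a, b]`: there is a finite partition
`a = p 0 < p 1 < ⋯ < p n = b` such that `g` is `C^k` on each open subinterval, and `g` and its
derivatives of order `≤ k` have finite one-sided limits at both ends of each subinterval.
(The values of `g` at the partition points are unrestricted.) -/
def PiecewiseContDiff (k : ℕ) (g : ℝ → ℝ) (a b : ℝ) : Prop :=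
  ∃ (n : ℕ) (p : Fin (n + 1) → ℝ), StrictMono p ∧ p 0 = a ∧ p (Fin.last n) = b ∧
    ∀ i : Fin n,
      ContDiffOn ℝ (k : WithTop ℕ∞) g (Ioo (p i.castSucc) (p i.succ)) ∧
      ∀ j ≤ k,
        (∃ l : ℝ, Tendsto (iteratedDeriv j g) (𝓝[>] (p i.castSucc)) (𝓝 l)) ∧
        (∃ l : ℝ, Tendsto (iteratedDeriv j g) (𝓝[<] (p i.succ)) (𝓝 l))

/-- The function `C(θ) = ∫₀¹ (e^{θ x} - 1) g(x) dx`. -/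
noncomputable def levyCumulant (g : ℝ → ℝ) (θ : ℝ) : ℝ :=
  ∫ x in (0 : ℝ)..1, (Real.exp (θ * x) - 1) * g x

/-- The random variable `T` has the infinitely divisible distribution with Lévy measure
`g(x) dx` on `(0, 1]`: all exponential moments are finite and
`log E e^{θ T} = C(θ)` for every real `θ`. -/
def HasLevyDensity {Ω : Type*} [MeasurableSpace Ω] (T : Ω → ℝ) (P : Measure Ω)
    (g : ℝ → ℝ) : Prop :=
  ∀ θ : ℝ, Integrable (fun ω => Real.exp (θ * T ω)) P ∧ cgf T P θ = levyCumulant g θ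

/-- `f` is the defective density of `T`: the law of `T` is its atom at `0` plus `f(x) dx`.
The density is taken in the version that is continuous on `(1, ∞)`, so that `f(u)` is determined
by the law of `T` for every `u > 1`. -/
structure IsDefectiveDensity {Ω : Type*} [MeasurableSpace Ω] (T : Ω → ℝ) (P : Measure Ω)
    (f : ℝ → ℝ) : Prop where
  measurable : Measurable f
  nonneg : ∀ x, 0 ≤ f x
  law_eq : P.map T = (P.map T {0}) • Measure.dirac (0 : ℝ) +
    volume.withDensity (fun x => ENNReal.ofReal (f x))
  continuousOn : ContinuousOn f (Ioi 1)

/-- `σ_β = √(C''(β))`. -/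
noncomputable def tiltedSigma (g : ℝ → ℝ) (β : ℝ) : ℝ :=
  Real.sqrt (iteratedDeriv 2 (levyCumulant g) β)

/-- The main term `e^{C(β) - u β} / (√(2π) σ_β)`. -/
noncomputable def saddleTerm (g : ℝ → ℝ) (β u : ℝ) : ℝ :=
  Real.exp (levyCumulant g β - u * β) / (Real.sqrt (2 * Real.pi) * tiltedSigma g β)

/-- `F(u) = M(u) (1 + O(e(u)))` as `u → ∞`. -/
def EqMulOneAddBigO (F M e : ℝ → ℝ) : Prop :=
  ∃ r : ℝ → ℝ, r =O[atTop] e ∧ ∀ᶠ u in atTop, F u = M u * (1 + r u)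

/-!
Tilting the compound Poisson law of `T` by `e ^ (β x)` gives, up to a factor, the compound Poisson
law with Lévy measure `κ = e ^ (β x) g(x) dx`, whose characteristic function is an explicit
`exp (κ̂ t)`, again up to a factor. When `C'(β) = u` the tilted law has mean `u`, so Fourier
inversion at `u + v` becomes a saddle point integral centred at `t = 0`.

Because of the atom, `exp (κ̂ t)` tends to `1` at infinity and is not integrable. But `κ̂` is
square integrable by Plancherel, so `exp (κ̂ t) - 1 - κ̂ t` is integrable; the two subtracted
terms belong to the atom and to the density of `κ`, and both vanish on `(1, ∞)`.

Write `m₂` for the second moment of `κ`, which grows at least like a multiple of `u`. On `|t| ≤ 1`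
the centred exponent is `-m₂ t² / 2` up to a cubic term, and the higher moments are bounded by `m₂`.
On `|t| ≥ 1` its real part is at most `-c e ^ (β a)` for some `a, c > 0` by Cramér's condition for
`g(x) dx`, and this beats the exponential growth in `β` of every other quantity. The cubic term is
odd, so it integrates to zero at `v = 0`: this is why the density has a relative error `O(1 / m₂)`
and not just `O(1 / √m₂)`. At `u + v` the phase `e ^ (-i v t)` costs another `O(v / √m₂)`, and
integrating against `e ^ (-β v)` gives the tail.
-/

section Moments

theorem integrable_of_ae_mem_isCompact {X E : Type*} [TopologicalSpace X] [MeasurableSpace X]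
    [OpensMeasurableSpace X] [NormedAddCommGroup E] [SecondCountableTopologyEither X E]
    {κ : Measure X} [IsFiniteMeasure κ] {K : Set X} (hK : IsCompact K) (hκ : ∀ᵐ x ∂κ, x ∈ K)
    {f : X → E} (hf : Continuous f) : Integrable f κ := by
  obtain ⟨C, hC⟩ := hK.exists_bound_of_continuousOn hf.continuousOn
  exact .of_bound hf.aestronglyMeasurable C (hκ.mono hC)

theorem moment_id_eq_integral (n : ℕ) (κ : Measure ℝ) : moment id n κ = ∫ x, x ^ n ∂κ := rfl

theorem moment_id_zero (κ : Measure ℝ) : moment id 0 κ = κ.real univ := by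
  simp [moment_id_eq_integral]

theorem norm_charFun_le_moment_zero (κ : Measure ℝ) (t : ℝ) : ‖charFun κ t‖ ≤ moment id 0 κ :=
  moment_id_zero κ ▸ norm_charFun_le t

theorem re_charFun (κ : Measure ℝ) [IsFiniteMeasure κ] (t : ℝ) :
    (charFun κ t).re = ∫ x, Real.cos (t * x) ∂κ := by
  have hint : Integrable (fun x : ℝ => Complex.exp (t * x * Complex.I)) κ :=
    .of_bound (by fun_prop) 1 (.of_forall fun x => by
      rw [← Complex.ofReal_mul, Complex.norm_exp_ofReal_mul_I])
  rw [charFun_apply_real, ← RCLike.re_eq_complex_re, ← integral_re hint]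
  refine integral_congr_ae (.of_forall fun x => ?_)
  simp [Complex.exp_re]

variable {κ : Measure ℝ} (hκ : ∀ᵐ x ∂κ, x ∈ Icc (0 : ℝ) 1)
include hκ

theorem moment_id_nonneg (n : ℕ) : 0 ≤ moment id n κ :=
  integral_nonneg_of_ae (hκ.mono fun _ hx => pow_nonneg hx.1 n)

variable [IsFiniteMeasure κ]

theorem integrable_pow (n : ℕ) : Integrable (fun x : ℝ => x ^ n) κ :=
  integrable_of_ae_mem_isCompact isCompact_Icc hκ (by fun_prop)

theorem moment_id_antitone : Antitone fun n => moment id n κ := fun _ _ hnm =>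
  integral_mono_ae (integrable_pow hκ _) (integrable_pow hκ _)
    (hκ.mono fun _ hx => pow_le_pow_of_le_one hx.1 hx.2 hnm)

theorem norm_charFun_sub_sum_moment_le {n : ℕ} (hn : 0 < n) {t : ℝ} (ht : |t| ≤ 1) :
    ‖charFun κ t - ∑ k ∈ Finset.range n, (t * Complex.I) ^ k / k.factorial * moment id k κ‖ ≤
      |t| ^ n * ((n.succ : ℝ) * (n.factorial * n : ℝ)⁻¹) * moment id n κ := by
  have hsum : ∑ k ∈ Finset.range n, (t * Complex.I) ^ k / k.factorial * moment id k κ =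
      ∫ x : ℝ, ∑ k ∈ Finset.range n, (t * x * Complex.I) ^ k / k.factorial ∂κ := by
    rw [integral_finsetSum _ fun k _ => integrable_of_ae_mem_isCompact isCompact_Icc hκ
      (by fun_prop)]
    refine Finset.sum_congr rfl fun k _ => ?_
    rw [moment_id_eq_integral, ← integral_complex_ofReal, ← integral_const_mul]
    refine integral_congr_ae (.of_forall fun x => ?_)
    push_cast
    ring
  rw [hsum, charFun_apply_real, ← integral_sub
    (integrable_of_ae_mem_isCompact isCompact_Icc hκ (by fun_prop))
    (integrable_of_ae_mem_isCompact isCompact_Icc hκ (by fun_prop)),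
    moment_id_eq_integral, ← integral_const_mul]
  refine norm_integral_le_of_norm_le ((integrable_pow hκ n).const_mul _) (hκ.mono fun x hx => ?_)
  have hnorm : ‖t * x * Complex.I‖ = |t| * x := by simp [abs_of_nonneg hx.1]
  refine (Complex.exp_bound (by rw [hnorm]; exact mul_le_one₀ ht hx.1 hx.2) hn).trans_eq ?_
  rw [hnorm, mul_pow]
  ring

theorem norm_charFun_sub_cubic_le {t : ℝ} (ht : |t| ≤ 1) :
    ‖charFun κ t - moment id 0 κ - (moment id 1 κ * t : ℝ) * Complex.I -
        (-(moment id 2 κ * t ^ 2 / 2 : ℝ) - (moment id 3 κ * t ^ 3 / 6 : ℝ) * Complex.I)‖ ≤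
      moment id 4 κ * t ^ 4 := by
  have hm := moment_id_nonneg hκ 4
  have h := norm_charFun_sub_sum_moment_le hκ (n := 4) (by norm_num) ht
  have hcoeff : |t| ^ 4 * ((4 : ℕ).succ * ((4 : ℕ).factorial * (4 : ℕ) : ℝ)⁻¹) * moment id 4 κ ≤
      moment id 4 κ * t ^ 4 := by
    rw [(by decide : Even 4).pow_abs]
    norm_num [Nat.factorial]
    nlinarith [(by positivity : 0 ≤ t ^ 4 * moment id 4 κ)]
  refine (le_of_eq (congrArg norm ?_)).trans (h.trans hcoeff)
  simp only [Finset.sum_range_succ, Finset.sum_range_zero, Nat.factorial]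
  push_cast
  linear_combination ((t : ℂ) ^ 2 / 2 * moment id 2 κ +
    t ^ 3 * Complex.I / 6 * moment id 3 κ) * Complex.I_sq

theorem re_charFun_le {t : ℝ} (ht : |t| ≤ 1) :
    (charFun κ t).re ≤ moment id 0 κ - moment id 2 κ * t ^ 2 / 5 := by
  have hcos : ∀ᵐ x ∂κ, Real.cos (t * x) ≤ x ^ 0 - t ^ 2 / 5 * x ^ 2 := hκ.mono fun x hx => by
    have htx : |t * x| ≤ 1 := by
      rw [abs_mul, abs_of_nonneg hx.1]; exact mul_le_one₀ ht hx.1 hx.2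
    have hpi : 1 / 5 ≤ 2 / Real.pi ^ 2 := by
      rw [div_le_div_iff₀ (by norm_num) (by positivity)]
      nlinarith [Real.pi_lt_d2, Real.pi_pos]
    have := Real.cos_le_one_sub_mul_cos_sq (htx.trans (by linarith [Real.pi_gt_three]))
    nlinarith [mul_le_mul_of_nonneg_right hpi (sq_nonneg (t * x))]
  calc (charFun κ t).re = ∫ x, Real.cos (t * x) ∂κ := re_charFun κ t
    _ ≤ ∫ x, (x ^ 0 - t ^ 2 / 5 * x ^ 2) ∂κ :=
      integral_mono_ae (integrable_of_ae_mem_isCompact isCompact_Icc hκ (by fun_prop))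
        ((integrable_pow hκ 0).sub ((integrable_pow hκ 2).const_mul _)) hcos
    _ = moment id 0 κ - moment id 2 κ * t ^ 2 / 5 := by
      rw [integral_sub (integrable_pow hκ 0) ((integrable_pow hκ 2).const_mul _),
        integral_const_mul]
      simp only [moment_id_eq_integral]
      ring

end Moments

section Edgeworth

theorem norm_cexp_sub_one_sub_id_le (z : ℂ) :
    ‖Complex.exp z - 1 - z‖ ≤ ‖z‖ ^ 2 * (Real.exp z.re + 2) := by
  rcases le_total ‖z‖ 1 with hz | hz
  · refine (Complex.norm_exp_sub_one_sub_id_le hz).trans ?_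
    nlinarith [sq_nonneg ‖z‖, Real.exp_pos z.re]
  · have htriangle : ‖Complex.exp z - 1 - z‖ ≤ Real.exp z.re + 1 + ‖z‖ := by
      refine (norm_sub_le _ _).trans (add_le_add ((norm_sub_le _ _).trans ?_) le_rfl)
      rw [Complex.norm_exp, norm_one]
    nlinarith [Real.exp_pos z.re, (one_le_pow₀ hz : 1 ≤ ‖z‖ ^ 2)]

theorem norm_cexp_sub_cexp_le {z w : ℂ} {r : ℝ} (hz : z.re ≤ r) (hw : w.re ≤ r) :
    ‖Complex.exp z - Complex.exp w‖ ≤ Real.exp r * ‖z - w‖ := by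
  refine Convex.norm_image_sub_le_of_norm_deriv_le (𝕜 := ℂ) (s := {z : ℂ | z.re ≤ r})
    (fun x _ => Complex.differentiable_exp x) (fun x hx => ?_) (convex_halfSpace_re_le r) hw hz
  rw [Complex.deriv_exp, Complex.norm_exp]
  exact Real.exp_le_exp.2 hx

theorem norm_cexp_sub_exp_mul_one_sub_le {a b c : ℝ} {w : ℂ} (hw : w.re ≤ -c) (hca : c ≤ a) :
    ‖Complex.exp w - Real.exp (-a) * (1 - b * Complex.I)‖ ≤
      Real.exp (-c) * (‖w - (-a - b * Complex.I)‖ + 3 * b ^ 2) := by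
  have hlin : ‖Complex.exp w - Complex.exp (-a - b * Complex.I)‖ ≤
      Real.exp (-c) * ‖w - (-a - b * Complex.I)‖ :=
    norm_cexp_sub_cexp_le hw (by simpa using hca)
  have hquad : ‖Complex.exp (-a - b * Complex.I) - Real.exp (-a) * (1 - b * Complex.I)‖ ≤
      Real.exp (-c) * (3 * b ^ 2) := by
    have hb := norm_cexp_sub_one_sub_id_le (-(b * Complex.I))
    have hfactor : Complex.exp (-a - b * Complex.I) - Real.exp (-a) * (1 - b * Complex.I) =
        Real.exp (-a) * (Complex.exp (-(b * Complex.I)) - 1 - -(b * Complex.I)) := by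
      rw [sub_eq_add_neg (-(a : ℂ)), Complex.exp_add]
      push_cast
      ring
    rw [hfactor, norm_mul, Complex.norm_of_nonneg (Real.exp_pos _).le]
    gcongr
    refine hb.trans_eq ?_
    norm_num
    ring
  calc _ ≤ _ := norm_sub_le_norm_sub_add_norm_sub _ (Complex.exp (-a - b * Complex.I)) _
    _ ≤ _ := add_le_add hlin hquad
    _ = _ := by ring

theorem exp_neg_mul_sq_add_cube_le {y : ℝ} (hy : 0 ≤ y) :
    Real.exp (-(y / 5)) * (y ^ 2 + y ^ 3) ≤ 6200 * Real.exp (-(y / 10)) := by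
  have h2 := Real.pow_div_factorial_le_exp (y / 10) (by positivity) 2
  have h3 := Real.pow_div_factorial_le_exp (y / 10) (by positivity) 3
  norm_num [Nat.factorial] at h2 h3
  have hsplit : Real.exp (-(y / 10)) = Real.exp (-(y / 5)) * Real.exp (y / 10) := by
    rw [← Real.exp_add]; ring_nf
  rw [hsplit]
  nlinarith [Real.exp_pos (-(y / 5))]

/-- The Gaussian density `e^{-s t²/2}` in Fourier space with its first Edgeworth correction. -/
noncomputable def edgeworthTerm (s m t : ℝ) : ℂ :=
  (Real.exp (-(s * t ^ 2 / 2)) : ℝ) * (1 - (m * t ^ 3 / 6 : ℝ) * Complex.I)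

variable {s m₃ m₄ : ℝ} {w : ℝ → ℂ}

theorem norm_indicator_cexp_sub_edgeworthTerm_le (hs : 1 ≤ s) (h₃ : |m₃| ≤ s) (h₄ : m₄ ≤ s)
    (hw : ∀ t, |t| ≤ 1 →
      ‖w t - (-(s * t ^ 2 / 2 : ℝ) - (m₃ * t ^ 3 / 6 : ℝ) * Complex.I)‖ ≤ m₄ * t ^ 4)
    (hre : ∀ t, |t| ≤ 1 → (w t).re ≤ -(s * t ^ 2 / 5)) (t : ℝ) :
    ‖(Icc (-1) 1).indicator (fun t => Complex.exp (w t)) t - edgeworthTerm s m₃ t‖ ≤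
      6200 / s * Real.exp (-(s * t ^ 2 / 10)) := by
  have hs0 : 0 < s := by linarith
  have hsq : (m₃ * t ^ 3 / 6) ^ 2 ≤ s ^ 2 * t ^ 6 / 36 := by
    have := mul_le_mul_of_nonneg_right (sq_le_sq.2 (h₃.trans (le_abs_self s)))
      (by positivity : 0 ≤ t ^ 6)
    linarith
  have habsorb : Real.exp (-(s * t ^ 2 / 5)) * (s * t ^ 4 + s ^ 2 * t ^ 6) ≤
      6200 / s * Real.exp (-(s * t ^ 2 / 10)) := by
    have h := exp_neg_mul_sq_add_cube_le (y := s * t ^ 2) (by positivity)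
    rw [div_mul_eq_mul_div, le_div_iff₀ hs0]
    linarith
  refine le_trans ?_ habsorb
  by_cases ht : |t| ≤ 1
  · rw [indicator_of_mem (mem_Icc.2 (abs_le.1 ht))]
    refine (norm_cexp_sub_exp_mul_one_sub_le (hre t ht) (by nlinarith [sq_nonneg t])).trans ?_
    refine mul_le_mul_of_nonneg_left ?_ (Real.exp_pos _).le
    have := mul_le_mul_of_nonneg_right h₄ (by positivity : 0 ≤ t ^ 4)
    linarith [hw t ht, (by positivity : 0 ≤ s ^ 2 * t ^ 6)]
  · rw [indicator_of_notMem fun h => ht (abs_le.2 (mem_Icc.1 h)), zero_sub, norm_neg,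
      edgeworthTerm, norm_mul, Complex.norm_of_nonneg (Real.exp_pos _).le]
    have ht2 : 1 ≤ t ^ 2 := by rw [← sq_abs]; exact one_le_pow₀ (not_le.1 ht).le
    have hst4 : 1 ≤ s * t ^ 4 := one_le_mul_of_one_le_of_one_le hs
      (by simpa only [← pow_mul] using one_le_pow₀ ht2 (n := 2))
    have hst6 : 1 ≤ s ^ 2 * t ^ 6 := one_le_mul_of_one_le_of_one_le (one_le_pow₀ hs)
      (by simpa only [← pow_mul] using one_le_pow₀ ht2 (n := 3))
    have hb : ‖1 - ((m₃ * t ^ 3 / 6 : ℝ) : ℂ) * Complex.I‖ ≤ 1 + |m₃ * t ^ 3 / 6| := by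
      refine (norm_sub_le _ _).trans_eq ?_
      rw [norm_one, norm_mul, Complex.norm_I, mul_one, Complex.norm_real, Real.norm_eq_abs]
    have hone : 1 + |m₃ * t ^ 3 / 6| ≤ s * t ^ 4 + s ^ 2 * t ^ 6 := by
      nlinarith [sq_abs (m₃ * t ^ 3 / 6), sq_nonneg (|m₃ * t ^ 3 / 6| - 1 / 2)]
    gcongr
    · linarith [(by positivity : 0 ≤ s * t ^ 2)]
    · exact hb.trans hone

theorem integral_eq_zero_of_odd {G E : Type*} [AddGroup G] [MeasurableSpace G] [MeasurableNeg G]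
    [NormedAddCommGroup E] [NormedSpace ℝ E] {μ : Measure G} [μ.IsNegInvariant] {f : G → E}
    (hf : f.Odd) : ∫ x, f x ∂μ = 0 := by
  have : IsAddTorsionFree E := .of_isTorsionFree ℝ E
  rw [← self_eq_neg, ← integral_neg, ← integral_neg_eq_self]
  exact integral_congr_ae (.of_forall hf)

theorem integrable_pow_mul_exp_neg_mul_sq {b : ℝ} (hb : 0 < b) (n : ℕ) :
    Integrable fun t : ℝ => t ^ n * Real.exp (-b * t ^ 2) := by
  have := integrable_rpow_mul_exp_neg_mul_sq hb (s := n) (by linarith [n.cast_nonneg (α := ℝ)])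
  exact_mod_cast this

theorem edgeworthTerm_eq_sub (s m t : ℝ) : edgeworthTerm s m t =
    (Real.exp (-(s / 2) * t ^ 2) : ℝ) -
      (t ^ 3 * Real.exp (-(s / 2) * t ^ 2) : ℝ) * (m / 6 * Complex.I) := by
  rw [edgeworthTerm, (by ring : -(s * t ^ 2 / 2) = -(s / 2) * t ^ 2)]
  push_cast
  ring

theorem integrable_edgeworthTerm (hs : 0 < s) (m : ℝ) : Integrable (edgeworthTerm s m) := by
  simp_rw [funext (edgeworthTerm_eq_sub s m)]
  exact (integrable_exp_neg_mul_sq (half_pos hs)).ofReal.sub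
    ((integrable_pow_mul_exp_neg_mul_sq (half_pos hs) 3).ofReal.mul_const _)

theorem integral_edgeworthTerm (hs : 0 < s) (m : ℝ) :
    ∫ t, edgeworthTerm s m t = (Real.sqrt (2 * Real.pi / s) : ℝ) := by
  have hodd : ∫ t : ℝ, ((t ^ 3 * Real.exp (-(s / 2) * t ^ 2) : ℝ) : ℂ) * (m / 6 * Complex.I) = 0 :=
    integral_eq_zero_of_odd fun t => by
      rw [(by decide : Odd 3).neg_pow, neg_sq]; push_cast; ring
  simp_rw [edgeworthTerm_eq_sub]
  rw [integral_sub (integrable_exp_neg_mul_sq (half_pos hs)).ofReal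
    ((integrable_pow_mul_exp_neg_mul_sq (half_pos hs) 3).ofReal.mul_const _), hodd, sub_zero,
    integral_complex_ofReal, integral_gaussian]
  rw [(by field_simp : Real.pi / (s / 2) = 2 * Real.pi / s)]

end Edgeworth

section LocalLimit

/-- The characteristic function of `∑_{n ≥ 2} κ^{∗n} / n!`, i.e. of the unnormalised compound
Poisson measure without its atom and its part with a single jump. If `charFun κ` is square
integrable then this is integrable. -/
noncomputable def poissonRemainder (κ : Measure ℝ) (t : ℝ) : ℂ :=
  Complex.exp (charFun κ t) - 1 - charFun κ t

/-- The Fourier inversion integral of `poissonRemainder` (without the factor `1 / 2π`). -/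
noncomputable def poissonInversion (κ : Measure ℝ) (x : ℝ) : ℂ :=
  ∫ t : ℝ, Complex.exp (-(x * t : ℝ) * Complex.I) * poissonRemainder κ t

/-- The inversion integral at distance `v` from the mean `m₁` of `κ`, divided by its Gaussian
approximation `e^{m₀} √(2π / m₂)`. -/
noncomputable def saddleRatio (κ : Measure ℝ) (v : ℝ) : ℂ :=
  (Real.exp (-moment id 0 κ) * Real.sqrt (moment id 2 κ / (2 * Real.pi)) : ℝ) *
    poissonInversion κ (moment id 1 κ + v)

/-- The part near the saddle point of the centred and normalised inversion integrand. -/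
noncomputable def centralTerm (κ : Measure ℝ) : ℝ → ℂ :=
  (Icc (-1) 1).indicator fun t =>
    Complex.exp (charFun κ t - moment id 0 κ - (moment id 1 κ * t : ℝ) * Complex.I)

/-- What `centralTerm` leaves of the centred and normalised inversion integrand. -/
noncomputable def tailTerm (κ : Measure ℝ) (t : ℝ) : ℂ :=
  Complex.exp (-(moment id 1 κ * t : ℝ) * Complex.I) *
    ((Real.exp (-moment id 0 κ) : ℝ) * poissonRemainder κ t) - centralTerm κ t

theorem norm_cexp_neg_ofReal_mul_I (x : ℝ) : ‖Complex.exp (-(x : ℂ) * Complex.I)‖ = 1 := by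
  rw [← Complex.ofReal_neg, Complex.norm_exp_ofReal_mul_I]

variable {κ : Measure ℝ}

theorem norm_poissonRemainder_le (t : ℝ) :
    ‖poissonRemainder κ t‖ ≤ ‖charFun κ t‖ ^ 2 * (Real.exp (charFun κ t).re + 2) :=
  norm_cexp_sub_one_sub_id_le _

theorem saddleRatio_eq_integral (v : ℝ) :
    saddleRatio κ v = (Real.sqrt (moment id 2 κ / (2 * Real.pi)) : ℝ) *
      ∫ t, Complex.exp (-(v * t : ℝ) * Complex.I) * (centralTerm κ t + tailTerm κ t) := by
  rw [saddleRatio, poissonInversion, mul_comm (Real.exp _), Complex.ofReal_mul, mul_assoc,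
    ← integral_const_mul]
  refine congrArg _ (integral_congr_ae (.of_forall fun t => ?_))
  have hexp : Complex.exp (-((moment id 1 κ + v) * t : ℝ) * Complex.I) =
      Complex.exp (-(v * t : ℝ) * Complex.I) *
        Complex.exp (-(moment id 1 κ * t : ℝ) * Complex.I) := by
    rw [← Complex.exp_add]; congr 1; push_cast; ring
  simp only [tailTerm, add_sub_cancel, hexp]
  ring

theorem tailTerm_of_abs_le_one {t : ℝ} (ht : |t| ≤ 1) :
    tailTerm κ t = -(Complex.exp (-(moment id 1 κ * t : ℝ) * Complex.I) *
      ((Real.exp (-moment id 0 κ) : ℝ) * (1 + charFun κ t))) := by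
  have hsplit : Complex.exp (charFun κ t - moment id 0 κ - (moment id 1 κ * t : ℝ) * Complex.I) =
      Complex.exp (-(moment id 1 κ * t : ℝ) * Complex.I) *
        ((Real.exp (-moment id 0 κ) : ℝ) * Complex.exp (charFun κ t)) := by
    rw [Complex.ofReal_exp, ← Complex.exp_add, ← Complex.exp_add]
    congr 1
    push_cast
    ring
  rw [tailTerm, centralTerm, indicator_of_mem (mem_Icc.2 (abs_le.1 ht)), poissonRemainder, hsplit]
  ring

theorem tailTerm_of_one_lt_abs {t : ℝ} (ht : 1 < |t|) :
    tailTerm κ t = Complex.exp (-(moment id 1 κ * t : ℝ) * Complex.I) *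
      ((Real.exp (-moment id 0 κ) : ℝ) * poissonRemainder κ t) := by
  rw [tailTerm, centralTerm, indicator_of_notMem fun h => ht.not_ge (abs_le.2 (mem_Icc.1 h)),
    sub_zero]

theorem norm_tailTerm_le {δ : ℝ} (hδ₀ : δ ≤ moment id 0 κ)
    (hδ : ∀ t : ℝ, 1 ≤ |t| → (charFun κ t).re ≤ moment id 0 κ - δ) (t : ℝ) :
    ‖tailTerm κ t‖ ≤ Real.exp (-δ) *
      ((Icc (-1 : ℝ) 1).indicator (fun _ => 1 + moment id 0 κ) t + 3 * ‖charFun κ t‖ ^ 2) := by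
  have hexp : Real.exp (-moment id 0 κ) ≤ Real.exp (-δ) := Real.exp_le_exp.2 (by linarith)
  rcases le_or_gt |t| 1 with ht | ht
  · have hφ := norm_charFun_le_moment_zero κ t
    rw [tailTerm_of_abs_le_one ht, indicator_of_mem (mem_Icc.2 (abs_le.1 ht)), norm_neg, norm_mul,
      norm_cexp_neg_ofReal_mul_I, one_mul, norm_mul, Complex.norm_of_nonneg (Real.exp_pos _).le]
    gcongr
    refine (norm_add_le _ _).trans ?_
    rw [norm_one]
    linarith [sq_nonneg ‖charFun κ t‖]
  · rw [tailTerm_of_one_lt_abs ht,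
      indicator_of_notMem fun h => ht.not_ge (abs_le.2 (mem_Icc.1 h)), norm_mul,
      norm_cexp_neg_ofReal_mul_I, one_mul, norm_mul, Complex.norm_of_nonneg (Real.exp_pos _).le]
    calc Real.exp (-moment id 0 κ) * ‖poissonRemainder κ t‖
      _ ≤ Real.exp (-moment id 0 κ) *
          (‖charFun κ t‖ ^ 2 * (Real.exp (moment id 0 κ - δ) + 2)) := by
        gcongr
        refine (norm_poissonRemainder_le t).trans ?_
        gcongr
        exact hδ t ht.le
      _ = (Real.exp (-δ) + 2 * Real.exp (-moment id 0 κ)) * ‖charFun κ t‖ ^ 2 := by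
        rw [sub_eq_add_neg, Real.exp_add, Real.exp_neg (moment id 0 κ)]
        field_simp
      _ ≤ Real.exp (-δ) * (0 + 3 * ‖charFun κ t‖ ^ 2) := by nlinarith [sq_nonneg ‖charFun κ t‖]

variable [IsFiniteMeasure κ]

theorem continuous_poissonRemainder : Continuous (poissonRemainder κ) := by
  have := continuous_charFun (μ := κ)
  unfold poissonRemainder
  fun_prop

theorem integrable_poissonRemainder (h₂ : Integrable fun t => ‖charFun κ t‖ ^ 2) :
    Integrable (poissonRemainder κ) := by
  refine (h₂.mul_const (Real.exp (moment id 0 κ) + 2)).mono'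
    continuous_poissonRemainder.aestronglyMeasurable (.of_forall fun t => ?_)
  refine (norm_poissonRemainder_le t).trans ?_
  gcongr
  exact (Complex.re_le_norm _).trans (norm_charFun_le_moment_zero κ t)

theorem measurable_centralTerm : Measurable (centralTerm κ) := by
  have := continuous_charFun (μ := κ)
  exact Measurable.indicator (by fun_prop) measurableSet_Icc

theorem integral_norm_tailTerm_le {δ : ℝ} (hδ₀ : δ ≤ moment id 0 κ)
    (hδ : ∀ t : ℝ, 1 ≤ |t| → (charFun κ t).re ≤ moment id 0 κ - δ)
    (h₂ : Integrable fun t => ‖charFun κ t‖ ^ 2) :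
    Integrable (tailTerm κ) ∧ ∫ t, ‖tailTerm κ t‖ ≤
      Real.exp (-δ) * (2 * (1 + moment id 0 κ) + 3 * ∫ t, ‖charFun κ t‖ ^ 2) := by
  have hbox : Integrable ((Icc (-1 : ℝ) 1).indicator fun _ => 1 + moment id 0 κ) :=
    (integrable_indicator_iff measurableSet_Icc).2 (integrableOn_const (by simp))
  have hbound := (hbox.add (h₂.const_mul 3)).const_mul (Real.exp (-δ))
  have hmeas : AEStronglyMeasurable (tailTerm κ) := by
    refine (Measurable.sub ?_ measurable_centralTerm).aestronglyMeasurable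
    have := (continuous_poissonRemainder (κ := κ)).measurable
    fun_prop
  have hint : Integrable (tailTerm κ) := hbound.mono' hmeas (.of_forall (norm_tailTerm_le hδ₀ hδ))
  refine ⟨hint, (integral_mono hint.norm hbound (norm_tailTerm_le hδ₀ hδ)).trans_eq ?_⟩
  simp only [Pi.add_apply]
  rw [integral_const_mul, integral_add hbox (h₂.const_mul 3), integral_const_mul,
    integral_indicator_const _ measurableSet_Icc]
  norm_num

theorem abs_mul_exp_neg_mul_sq_le {s : ℝ} (hs : 0 < s) (t : ℝ) :
    |t| * Real.exp (-(s * t ^ 2 / 5)) ≤ 2 / Real.sqrt s * Real.exp (-(s * t ^ 2 / 10)) := by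
  have hsqrt := Real.sqrt_pos.2 hs
  have hx : Real.sqrt s * |t| ≤ 2 * Real.exp (s * t ^ 2 / 10) := by
    have hsq : s * t ^ 2 = (Real.sqrt s * |t|) ^ 2 := by
      rw [mul_pow, Real.sq_sqrt hs.le, sq_abs]
    nlinarith [Real.add_one_le_exp (s * t ^ 2 / 10), sq_nonneg (Real.sqrt s * |t| - 2)]
  have hsplit : Real.exp (-(s * t ^ 2 / 10)) =
      Real.exp (s * t ^ 2 / 10) * Real.exp (-(s * t ^ 2 / 5)) := by
    rw [← Real.exp_add]; ring_nf
  rw [hsplit, div_mul_eq_mul_div, le_div_iff₀ hsqrt]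
  nlinarith [Real.exp_pos (-(s * t ^ 2 / 5))]

variable (hκ : ∀ᵐ x ∂κ, x ∈ Icc (0 : ℝ) 1)
include hκ

theorem re_centralExponent_le {t : ℝ} (ht : |t| ≤ 1) :
    (charFun κ t - moment id 0 κ - (moment id 1 κ * t : ℝ) * Complex.I).re ≤
      -(moment id 2 κ * t ^ 2 / 5) := by
  rw [Complex.sub_re, Complex.sub_re, Complex.ofReal_re, Complex.re_ofReal_mul, Complex.I_re]
  linarith [re_charFun_le hκ ht]

theorem norm_centralTerm_le (t : ℝ) :
    ‖centralTerm κ t‖ ≤ Real.exp (-(moment id 2 κ * t ^ 2 / 5)) := by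
  rw [centralTerm, indicator]
  split_ifs with ht
  · rw [Complex.norm_exp]
    exact Real.exp_le_exp.2 (re_centralExponent_le hκ (abs_le.2 (mem_Icc.1 ht)))
  · rw [norm_zero]
    positivity

theorem norm_centralTerm_sub_edgeworthTerm_le (hs : 1 ≤ moment id 2 κ) (t : ℝ) :
    ‖centralTerm κ t - edgeworthTerm (moment id 2 κ) (moment id 3 κ) t‖ ≤
      6200 / moment id 2 κ * Real.exp (-(moment id 2 κ * t ^ 2 / 10)) := by
  refine norm_indicator_cexp_sub_edgeworthTerm_le hs ?_ (moment_id_antitone hκ (by norm_num))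
    (fun t => norm_charFun_sub_cubic_le hκ) (fun t => re_centralExponent_le hκ) t
  rw [abs_of_nonneg (moment_id_nonneg hκ 3)]
  exact moment_id_antitone hκ (by norm_num)

theorem norm_cexp_mul_add_sub_edgeworthTerm_le (hs : 1 ≤ moment id 2 κ) {v : ℝ} (hv : 0 ≤ v)
    (t : ℝ) :
    ‖Complex.exp (-(v * t : ℝ) * Complex.I) * (centralTerm κ t + tailTerm κ t) -
        edgeworthTerm (moment id 2 κ) (moment id 3 κ) t‖ ≤
      (2 * v / Real.sqrt (moment id 2 κ) + 6200 / moment id 2 κ) *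
        Real.exp (-(moment id 2 κ * t ^ 2 / 10)) + ‖tailTerm κ t‖ := by
  set e := Complex.exp (-(v * t : ℝ) * Complex.I) with he
  have hrot : ‖e - 1‖ ≤ v * |t| := by
    have h := Real.norm_exp_I_mul_ofReal_sub_one_le (x := -(v * t))
    rwa [mul_comm, Complex.ofReal_neg, ← he, norm_neg, Real.norm_eq_abs, abs_mul,
      abs_of_nonneg hv] at h
  have hcentral : ‖(e - 1) * centralTerm κ t‖ ≤
      2 * v / Real.sqrt (moment id 2 κ) * Real.exp (-(moment id 2 κ * t ^ 2 / 10)) := by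
    have h := mul_le_mul_of_nonneg_left (abs_mul_exp_neg_mul_sq_le (zero_lt_one.trans_le hs) t) hv
    rw [norm_mul]
    calc _ ≤ v * |t| * Real.exp (-(moment id 2 κ * t ^ 2 / 5)) := by
          gcongr; exact norm_centralTerm_le hκ t
      _ ≤ _ := by linear_combination h
  have htail : ‖e * tailTerm κ t‖ = ‖tailTerm κ t‖ := by
    rw [norm_mul, he, norm_cexp_neg_ofReal_mul_I, one_mul]
  calc _ = ‖(e - 1) * centralTerm κ t +
        (centralTerm κ t - edgeworthTerm (moment id 2 κ) (moment id 3 κ) t) +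
          e * tailTerm κ t‖ := by congr 1; ring
    _ ≤ _ := norm_add₃_le
    _ ≤ _ := add_le_add_left (add_le_add hcentral
        (norm_centralTerm_sub_edgeworthTerm_le hκ hs t)) _
    _ = _ := by rw [htail]; ring

theorem integrable_centralTerm (hs : 0 < moment id 2 κ) : Integrable (centralTerm κ) := by
  refine (integrable_exp_neg_mul_sq (by positivity : 0 < moment id 2 κ / 5)).mono'
    measurable_centralTerm.aestronglyMeasurable (.of_forall fun t => ?_)
  exact (norm_centralTerm_le hκ t).trans_eq (by ring_nf)

theorem norm_integral_sub_sqrt_le (hs : 1 ≤ moment id 2 κ) (htail : Integrable (tailTerm κ))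
    {v : ℝ} (hv : 0 ≤ v) :
    ‖(∫ t, Complex.exp (-(v * t : ℝ) * Complex.I) * (centralTerm κ t + tailTerm κ t)) -
        (Real.sqrt (2 * Real.pi / moment id 2 κ) : ℝ)‖ ≤
      (2 * v / Real.sqrt (moment id 2 κ) + 6200 / moment id 2 κ) *
        Real.sqrt (10 * Real.pi / moment id 2 κ) + ∫ t, ‖tailTerm κ t‖ := by
  have hs0 : 0 < moment id 2 κ := zero_lt_one.trans_le hs
  have hgauss : Integrable fun t : ℝ => Real.exp (-(moment id 2 κ / 10) * t ^ 2) :=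
    integrable_exp_neg_mul_sq (by positivity)
  have hrot : Integrable fun t =>
      Complex.exp (-(v * t : ℝ) * Complex.I) * (centralTerm κ t + tailTerm κ t) :=
    ((integrable_centralTerm hκ hs0).add htail).bdd_mul (c := 1) (by fun_prop)
      (.of_forall fun t => (norm_cexp_neg_ofReal_mul_I _).le)
  have hbound (t : ℝ) := norm_cexp_mul_add_sub_edgeworthTerm_le hκ hs hv t
  set A := 2 * v / Real.sqrt (moment id 2 κ) + 6200 / moment id 2 κ
  rw [← integral_edgeworthTerm hs0 (moment id 3 κ),
    ← integral_sub hrot (integrable_edgeworthTerm hs0 _)]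
  refine (norm_integral_le_of_norm_le ((hgauss.const_mul A).add htail.norm)
    (.of_forall fun t => (hbound t).trans_eq (by rw [Pi.add_apply]; ring_nf))).trans_eq ?_
  rw [integral_add' (hgauss.const_mul A) htail.norm, integral_const_mul, integral_gaussian,
    (by field_simp : Real.pi / (moment id 2 κ / 10) = 10 * Real.pi / moment id 2 κ)]

theorem norm_saddleRatio_sub_one_le (hs : 1 ≤ moment id 2 κ) {δ : ℝ} (hδ₀ : δ ≤ moment id 0 κ)
    (hδ : ∀ t : ℝ, 1 ≤ |t| → (charFun κ t).re ≤ moment id 0 κ - δ)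
    (h₂ : Integrable fun t => ‖charFun κ t‖ ^ 2) {v : ℝ} (hv : 0 ≤ v) :
    ‖saddleRatio κ v - 1‖ ≤ 6 * v / Real.sqrt (moment id 2 κ) + 18600 / moment id 2 κ +
      Real.sqrt (moment id 2 κ) * (Real.exp (-δ) *
        (2 * (1 + moment id 0 κ) + 3 * ∫ t, ‖charFun κ t‖ ^ 2)) := by
  obtain ⟨htail, htail_le⟩ := integral_norm_tailTerm_le hδ₀ hδ h₂
  have hint := norm_integral_sub_sqrt_le hκ hs htail hv
  rw [saddleRatio_eq_integral]
  set s := moment id 2 κ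
  have hs0 : 0 < s := zero_lt_one.trans_le hs
  set r := Real.sqrt (s / (2 * Real.pi)) with hr
  have hr_inv : r * Real.sqrt (2 * Real.pi / s) = 1 := by
    rw [hr, ← Real.sqrt_mul (by positivity), Real.sqrt_eq_one]; field_simp
  have hr_five : r * Real.sqrt (10 * Real.pi / s) ≤ 3 := by
    rw [hr, ← Real.sqrt_mul (by positivity), Real.sqrt_le_iff]
    refine ⟨by norm_num, ?_⟩
    field_simp
    norm_num
  have hr_le : r ≤ Real.sqrt s :=
    Real.sqrt_le_sqrt (div_le_self hs0.le (by linarith [Real.pi_gt_three]))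
  have hone : (1 : ℂ) = r * Real.sqrt (2 * Real.pi / s) := by exact_mod_cast hr_inv.symm
  rw [hone, ← mul_sub, norm_mul, Complex.norm_of_nonneg (Real.sqrt_nonneg _)]
  calc _ ≤ r * ((2 * v / Real.sqrt s + 6200 / s) * Real.sqrt (10 * Real.pi / s) +
        ∫ t, ‖tailTerm κ t‖) := by gcongr
    _ = (2 * v / Real.sqrt s + 6200 / s) * (r * Real.sqrt (10 * Real.pi / s)) +
        r * ∫ t, ‖tailTerm κ t‖ := by ring
    _ ≤ (2 * v / Real.sqrt s + 6200 / s) * 3 + Real.sqrt s * (Real.exp (-δ) *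
        (2 * (1 + moment id 0 κ) + 3 * ∫ t, ‖charFun κ t‖ ^ 2)) := by gcongr
    _ = _ := by ring

end LocalLimit

section Density

/-- The measure `k(x) dx` on the real line; the negative part of `k` is ignored. -/
noncomputable def measureOfDensity (k : ℝ → ℝ) : Measure ℝ :=
  volume.withDensity fun x => ENNReal.ofReal (k x)

theorem measureOfDensity_absolutelyContinuous (k : ℝ → ℝ) : measureOfDensity k ≪ volume :=
  withDensity_absolutelyContinuous _ _

variable {k : ℝ → ℝ}

theorem isFiniteMeasure_measureOfDensity (hk : Integrable k) :
    IsFiniteMeasure (measureOfDensity k) :=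
  isFiniteMeasure_withDensity_ofReal hk.2

theorem measureOfDensity_toReal_rnDeriv {ν : Measure ℝ} [IsFiniteMeasure ν] (hν : ν ≪ volume) :
    measureOfDensity (fun x => (ν.rnDeriv volume x).toReal) = ν := by
  rw [measureOfDensity, withDensity_congr_ae ((ν.rnDeriv_lt_top volume).mono fun x hx =>
    ENNReal.ofReal_toReal hx.ne), Measure.withDensity_rnDeriv_eq ν volume hν]

variable {E : Type*} [NormedAddCommGroup E] [NormedSpace ℝ E]

theorem integrable_measureOfDensity_iff (hk : AEMeasurable k) (hk₀ : 0 ≤ᵐ[volume] k)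
    {φ : ℝ → E} : Integrable φ (measureOfDensity k) ↔ Integrable fun x => k x • φ x := by
  rw [measureOfDensity, integrable_withDensity_iff_integrable_smul₀' hk.ennreal_ofReal (by simp)]
  exact integrable_congr (hk₀.mono fun x hx => by simp only [ENNReal.toReal_ofReal hx])

theorem integral_measureOfDensity (hk : AEMeasurable k) (hk₀ : 0 ≤ᵐ[volume] k) (φ : ℝ → E) :
    ∫ x, φ x ∂measureOfDensity k = ∫ x, k x • φ x := by
  rw [measureOfDensity, integral_withDensity_eq_integral_toReal_smul₀ hk.ennreal_ofReal (by simp)]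
  exact integral_congr_ae (hk₀.mono fun x hx => by simp only [ENNReal.toReal_ofReal hx])

end Density

section Fourier

open scoped FourierTransform

theorem fourier_ae_eq_fourier_toLp {f : ℝ → ℂ} (h₁ : Integrable f) (h₂ : MemLp f 2) :
    𝓕 f =ᵐ[volume] (𝓕 (h₂.toLp f) : Lp ℂ 2 (volume : Measure ℝ)) := by
  have hcont : Continuous (𝓕 f) := VectorFourier.fourierIntegral_continuous
    Real.continuous_fourierChar continuous_inner h₁
  refine ae_eq_of_integral_contDiff_smul_eq hcont.locallyIntegrable
    ((Lp.memLp _).locallyIntegrable (by norm_num)) fun φ hφ hφc => ?_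
  have hcompact : HasCompactSupport (Complex.ofRealCLM ∘ φ) := hφc.comp_left rfl
  have hsmooth : ContDiff ℝ (↑(⊤ : ℕ∞)) (Complex.ofRealCLM ∘ φ) := by fun_prop
  set ψ := hcompact.toSchwartzMap hsmooth
  have hψ (x : ℝ) : ψ x = (φ x : ℂ) := rfl
  have hdistribution := congrArg (fun T => T ψ) (Lp.fourier_toTemperedDistribution_eq (h₂.toLp f))
  simp only [TemperedDistribution.fourier_apply, Lp.toTemperedDistribution_apply, hψ]
    at hdistribution
  have hself_adjoint := VectorFourier.integral_fourierIntegral_smul_eq_flip (L := innerₗ ℝ)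
    Real.continuous_fourierChar continuous_inner ψ.integrable h₁ (μ := volume) (ν := volume)
  rw [flip_innerₗ] at hself_adjoint
  have hrepresentative : ∫ x, (𝓕 ψ) x • (h₂.toLp f) x = ∫ x, (𝓕 ψ) x • f x :=
    integral_congr_ae (h₂.coeFn_toLp.mono fun x hx => by simp only [hx])
  simp only [← Complex.coe_smul]
  exact hself_adjoint.symm.trans (hrepresentative.symm.trans hdistribution)

theorem eLpNorm_two_fourier {f : ℝ → ℂ} (h₁ : Integrable f) (h₂ : MemLp f 2) :
    eLpNorm (𝓕 f) 2 = eLpNorm f 2 := by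
  rw [eLpNorm_congr_ae (fourier_ae_eq_fourier_toLp h₁ h₂), ← Lp.enorm_def,
    ← eLpNorm_congr_ae h₂.coeFn_toLp, ← Lp.enorm_def, enorm_eq_iff_norm_eq, Lp.norm_fourier_eq]

theorem integral_sq_norm_eq_toReal_eLpNorm {X E : Type*} [MeasurableSpace X] {μ : Measure X}
    [NormedAddCommGroup E] {f : X → E} (hf : MemLp f 2 μ) :
    ∫ x, ‖f x‖ ^ 2 ∂μ = (eLpNorm f 2 μ).toReal ^ 2 := by
  rw [hf.eLpNorm_eq_integral_rpow_norm two_ne_zero ENNReal.ofNat_ne_top,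
    ENNReal.toReal_ofReal (by positivity), ENNReal.toReal_ofNat, ← Real.rpow_natCast (_ ^ _),
    ← Real.rpow_mul (by positivity)]
  simp

theorem memLp_two_fourier {f : ℝ → ℂ} (h₁ : Integrable f) (h₂ : MemLp f 2) : MemLp (𝓕 f) 2 :=
  (memLp_congr_ae (fourier_ae_eq_fourier_toLp h₁ h₂)).2 (Lp.memLp _)

theorem charFun_measureOfDensity {k : ℝ → ℝ} (hk : AEMeasurable k) (hk₀ : 0 ≤ᵐ[volume] k)
    (t : ℝ) : charFun (measureOfDensity k) t = 𝓕 (fun x => (k x : ℂ)) (-(2 * Real.pi)⁻¹ * t) := by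
  rw [charFun_apply_real, integral_measureOfDensity hk hk₀,
    Real.fourier_real_eq_integral_exp_smul]
  refine integral_congr_ae (.of_forall fun x => ?_)
  simp only [smul_eq_mul, Complex.real_smul, mul_comm (k x : ℂ)]
  congr 2
  push_cast
  have : (Real.pi : ℂ) ≠ 0 := Complex.ofReal_ne_zero.2 Real.pi_ne_zero
  field_simp

theorem integrable_sq_norm_charFun {k : ℝ → ℝ} (hk₀ : 0 ≤ᵐ[volume] k) (h₁ : Integrable k)
    (h₂ : MemLp k 2) : Integrable fun t => ‖charFun (measureOfDensity k) t‖ ^ 2 := by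
  have hF : MemLp (𝓕 fun x => (k x : ℂ)) 2 := memLp_two_fourier h₁.ofReal h₂.ofReal
  simp only [charFun_measureOfDensity h₁.aemeasurable hk₀]
  exact ((memLp_two_iff_integrable_sq_norm hF.1).1 hF).comp_mul_left'
    (neg_ne_zero.2 (by positivity))

theorem integral_sq_norm_charFun {k : ℝ → ℝ} (hk₀ : 0 ≤ᵐ[volume] k) (h₁ : Integrable k)
    (h₂ : MemLp k 2) :
    ∫ t, ‖charFun (measureOfDensity k) t‖ ^ 2 = 2 * Real.pi * ∫ x, k x ^ 2 := by
  have h₁' : Integrable fun x => (k x : ℂ) := h₁.ofReal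
  have h₂' : MemLp (fun x => (k x : ℂ)) 2 := h₂.ofReal
  simp only [charFun_measureOfDensity h₁.aemeasurable hk₀]
  rw [Measure.integral_comp_mul_left (fun ξ => ‖𝓕 (fun x => (k x : ℂ)) ξ‖ ^ 2), inv_neg, inv_inv,
    abs_neg, abs_of_pos (by positivity), smul_eq_mul,
    integral_sq_norm_eq_toReal_eLpNorm (memLp_two_fourier h₁' h₂'),
    eLpNorm_two_fourier h₁' h₂', ← integral_sq_norm_eq_toReal_eLpNorm h₂']
  simp only [Complex.norm_real, Real.norm_eq_abs, sq_abs]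

variable {ν : Measure ℝ} [IsFiniteMeasure ν]

theorem tendsto_charFun_cocompact (hν : ν ≪ volume) :
    Tendsto (charFun ν) (cocompact ℝ) (𝓝 0) := by
  have hscale : Tendsto (fun t : ℝ => -(2 * Real.pi)⁻¹ * t) (cocompact ℝ) (cocompact ℝ) :=
    (Homeomorph.mulLeft₀ (-(2 * Real.pi)⁻¹) (neg_ne_zero.2 (by positivity))).map_cocompact.le
  refine ((Real.zero_at_infty_fourier fun x => ((ν.rnDeriv volume x).toReal : ℂ)).comp
    hscale).congr fun t => ?_
  rw [Function.comp_apply, ← charFun_measureOfDensity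
    (ν.measurable_rnDeriv volume).ennreal_toReal.aemeasurable
    (.of_forall fun _ => ENNReal.toReal_nonneg), measureOfDensity_toReal_rnDeriv hν]

theorem re_charFun_lt (hν : ν ≪ volume) (hν₀ : ν ≠ 0) {t : ℝ} (ht : t ≠ 0) :
    (charFun ν t).re < moment id 0 ν := by
  have hcos : ∀ᵐ x ∂ν, Real.cos (t * x) ≠ 1 := by
    refine hν.ae_le (ae_iff.2 (Countable.measure_zero ?_ _))
    refine (countable_range fun n : ℤ => n * (2 * Real.pi) / t).mono fun x hx => ?_
    obtain ⟨n, hn⟩ := (Real.cos_eq_one_iff _).1 (not_not.1 hx)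
    exact ⟨n, by simp only [hn]; field_simp⟩
  have hint : Integrable (fun x => Real.cos (t * x)) ν :=
    .of_bound (by fun_prop) 1 (.of_forall fun x => Real.abs_cos_le_one _)
  have hpos : 0 < ∫ x, (1 - Real.cos (t * x)) ∂ν := by
    rw [integral_pos_iff_support_of_nonneg (fun x => sub_nonneg.2 (Real.cos_le_one _))
      ((integrable_const 1).sub hint)]
    refine pos_iff_ne_zero.2 fun h => hν₀ (ae_eq_bot.1 (eventually_false_iff_eq_bot.1 ?_))
    filter_upwards [hcos, measure_eq_zero_iff_ae_notMem.1 h] with x hx hx'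
    exact hx (sub_eq_zero.1 (Function.notMem_support.1 hx')).symm
  rw [integral_sub (integrable_const 1) hint, ← re_charFun] at hpos
  rw [moment_id_zero]
  simpa using hpos

theorem exists_re_charFun_le (hν : ν ≪ volume) (hν₀ : ν ≠ 0) :
    ∃ c ∈ Ioc 0 (moment id 0 ν), ∀ t : ℝ, 1 ≤ |t| → (charFun ν t).re ≤ moment id 0 ν - c := by
  have hmass : 0 < moment id 0 ν := by
    rw [moment_id_zero]
    have : NeZero ν := ⟨hν₀⟩
    exact measureReal_univ_pos
  have hcont : Continuous fun t => max (charFun ν t).re (moment id 0 ν / 2) := by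
    have := continuous_charFun (μ := ν)
    fun_prop
  have hlim := (Complex.continuous_re.tendsto 0).comp (tendsto_charFun_cocompact hν)
  have hclosed : IsClosed {t : ℝ | 1 ≤ |t|} := isClosed_le continuous_const continuous_abs
  obtain ⟨s, hs, hmax⟩ := hcont.continuousOn.exists_isMaxOn' hclosed (x₀ := 1)
    (by simp) (mem_inf_of_left ((hlim.eventually_lt_const
      (by simpa using half_pos hmass)).mono fun t ht =>
        (max_eq_right ht.le).trans_le (le_max_right _ _)))
  have hs₀ : s ≠ 0 := fun h => by simp [h] at hs; linarith
  refine ⟨moment id 0 ν - max (charFun ν s).re (moment id 0 ν / 2),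
    ⟨sub_pos.2 (max_lt (re_charFun_lt hν hν₀ hs₀) (half_lt_self hmass)), ?_⟩, fun t ht => ?_⟩
  · linarith [le_max_right (charFun ν s).re (moment id 0 ν / 2)]
  · rw [sub_sub_cancel]
    exact (le_max_left _ _).trans (hmax ht)

end Fourier

section ConvExp

section AddMonoid

variable {M : Type*} [AddMonoid M] [MeasurableSpace M]

/-- The convolution power `ν^{∗n}`. -/
noncomputable def convPow (ν : Measure M) : ℕ → Measure M
  | 0 => Measure.dirac 0
  | n + 1 => convPow ν n ∗ ν

/-- The convolution exponential `∑ ν^{∗n} / n!`. For a finite measure `ν` this is `e^{ν(M)}` times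
the compound Poisson distribution with Lévy measure `ν`. -/
noncomputable def convExp (ν : Measure M) : Measure M :=
  Measure.sum fun n : ℕ => ENNReal.ofReal (n.factorial : ℝ)⁻¹ • convPow ν n

instance isFiniteMeasure_convPow (ν : Measure M) [IsFiniteMeasure ν] (n : ℕ) :
    IsFiniteMeasure (convPow ν n) := by
  induction n with
  | zero => exact inferInstanceAs (IsFiniteMeasure (Measure.dirac 0))
  | succ n ih => exact inferInstanceAs (IsFiniteMeasure (convPow ν n ∗ ν))

variable [MeasurableAdd₂ M]

theorem convPow_univ (ν : Measure M) [SFinite ν] (n : ℕ) : convPow ν n univ = ν univ ^ n := by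
  induction n with
  | zero => simp [convPow]
  | succ n ih =>
    rw [convPow, ← lintegral_one, Measure.lintegral_conv (by fun_prop)]
    simp [ih, pow_succ, mul_comm]

theorem convExp_univ (ν : Measure M) [IsFiniteMeasure ν] :
    convExp ν univ = ENNReal.ofReal (Real.exp (ν.real univ)) := by
  have hsum := NormedSpace.expSeries_div_hasSum_exp (ν.real univ)
  rw [← Real.exp_eq_exp_ℝ] at hsum
  rw [convExp, Measure.sum_apply _ .univ, ← hsum.tsum_eq,
    ENNReal.ofReal_tsum_of_nonneg (fun n => by positivity) hsum.summable]
  refine tsum_congr fun n => ?_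
  rw [Measure.smul_apply, convPow_univ, smul_eq_mul, div_eq_inv_mul,
    ENNReal.ofReal_mul (by positivity), ENNReal.ofReal_pow measureReal_nonneg,
    ofReal_measureReal]

instance isFiniteMeasure_convExp (ν : Measure M) [IsFiniteMeasure ν] :
    IsFiniteMeasure (convExp ν) :=
  ⟨by rw [convExp_univ]; exact ENNReal.ofReal_lt_top⟩

end AddMonoid

theorem exists_convExp_eq_dirac_add {G : Type*} [AddGroup G] [MeasurableSpace G]
    [MeasurableAdd₂ G] {ν μ : Measure G} [SFinite ν] [μ.IsAddLeftInvariant] (hν : ν ≪ μ) :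
    ∃ ρ, ρ ≪ μ ∧ convExp ν = Measure.dirac 0 + ρ := by
  refine ⟨Measure.sum fun n : ℕ => ENNReal.ofReal ((n + 1).factorial : ℝ)⁻¹ • convPow ν (n + 1),
    Measure.absolutelyContinuous_sum_left fun n =>
      (Measure.conv_absolutelyContinuous hν).smul_left _, ?_⟩
  ext s hs
  rw [convExp, Measure.add_apply, Measure.sum_apply _ hs, Measure.sum_apply _ hs,
    tsum_eq_zero_add' ENNReal.summable]
  simp [convPow]

section CharFun

variable {E : Type*} [NormedAddCommGroup E] [InnerProductSpace ℝ E] [MeasurableSpace E]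
  [BorelSpace E] [SecondCountableTopology E] (ν : Measure E) [IsFiniteMeasure ν]

theorem charFun_convPow (n : ℕ) (t : E) : charFun (convPow ν n) t = charFun ν t ^ n := by
  induction n with
  | zero => simp [convPow]
  | succ n ih => rw [convPow, charFun_conv, ih, pow_succ]

theorem charFun_convExp (t : E) : charFun (convExp ν) t = Complex.exp (charFun ν t) := by
  have hint : Integrable (fun x => Complex.exp (inner ℝ x t * Complex.I)) (convExp ν) :=
    .of_bound (by fun_prop) 1 (.of_forall fun x => by rw [Complex.norm_exp_ofReal_mul_I])
  have hterm (n : ℕ) : ∫ x, Complex.exp (inner ℝ x t * Complex.I)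
      ∂(ENNReal.ofReal (n.factorial : ℝ)⁻¹ • convPow ν n) = charFun ν t ^ n / n.factorial := by
    rw [integral_smul_measure, ← charFun_apply, charFun_convPow,
      ENNReal.toReal_ofReal (by positivity), Complex.real_smul, div_eq_inv_mul]
    push_cast
    rfl
  have hsum := hasSum_integral_measure hint
  simp only [hterm] at hsum
  rw [Complex.exp_eq_exp_ℂ]
  exact hsum.unique (NormedSpace.expSeries_div_hasSum_exp _)

end CharFun

end ConvExp

section Tilt

/-- The exponential tilt `e^{βx} μ(dx)`, not normalised to a probability measure. -/
noncomputable def expTilt (β : ℝ) (μ : Measure ℝ) : Measure ℝ :=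
  μ.withDensity fun x => ENNReal.ofReal (Real.exp (β * x))

variable (β : ℝ)

theorem expTilt_smul (c : ENNReal) (μ : Measure ℝ) : expTilt β (c • μ) = c • expTilt β μ :=
  withDensity_smul_measure _ _

theorem expTilt_dirac_zero : expTilt β (Measure.dirac 0) = Measure.dirac 0 := by
  simp [expTilt, dirac_withDensity]

theorem expTilt_conv (μ ν : Measure ℝ) [SFinite ν] :
    expTilt β (μ ∗ ν) = expTilt β μ ∗ expTilt β ν := by
  refine Measure.ext_of_lintegral _ fun f hf => ?_
  have : SFinite (expTilt β ν) := inferInstanceAs (SFinite (ν.withDensity _))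
  rw [expTilt, lintegral_withDensity_eq_lintegral_mul _ (by fun_prop) hf,
    Measure.lintegral_conv (by fun_prop), Measure.lintegral_conv (by fun_prop), expTilt,
    lintegral_withDensity_eq_lintegral_mul _ (by fun_prop) (by fun_prop)]
  refine lintegral_congr fun x => ?_
  rw [Pi.mul_apply, expTilt, lintegral_withDensity_eq_lintegral_mul _ (by fun_prop) (by fun_prop),
    ← lintegral_const_mul _ (by fun_prop)]
  refine lintegral_congr fun y => ?_
  simp only [Pi.mul_apply]
  rw [mul_add, Real.exp_add, ENNReal.ofReal_mul (by positivity), mul_assoc]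

theorem expTilt_convPow (ν : Measure ℝ) [SFinite ν] (n : ℕ) :
    expTilt β (convPow ν n) = convPow (expTilt β ν) n := by
  induction n with
  | zero => exact expTilt_dirac_zero β
  | succ n ih => rw [convPow, expTilt_conv, ih, convPow]

theorem expTilt_convExp (ν : Measure ℝ) [SFinite ν] :
    expTilt β (convExp ν) = convExp (expTilt β ν) := by
  rw [convExp, expTilt, withDensity_sum]
  refine congrArg _ (funext fun n => ?_)
  rw [← expTilt_convPow, ← expTilt_smul, expTilt]

theorem mgf_id_eq_expTilt_real_univ (μ : Measure ℝ) : mgf id μ β = (expTilt β μ).real univ := by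
  rw [mgf, integral_eq_lintegral_of_nonneg_ae (.of_forall fun x => (Real.exp_pos _).le)
    (by fun_prop), expTilt, Measure.real, withDensity_apply _ .univ, Measure.restrict_univ]
  rfl

end Tilt

theorem ext_of_mgf_id {μ μ' : Measure ℝ} [IsProbabilityMeasure μ] [IsFiniteMeasure μ']
    (hμ : 0 ∈ interior (integrableExpSet id μ)) (h : mgf id μ = mgf id μ') : μ = μ' := by
  refine Measure.ext_of_charFun (funext fun t => ?_)
  rw [← complexMGF_id_mul_I, ← complexMGF_id_mul_I]
  exact eqOn_complexMGF_of_mgf h (by simpa using hμ)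

theorem eq_smul_convExp_of_mgf_id_eq {μ ν : Measure ℝ} [IsProbabilityMeasure μ]
    [IsFiniteMeasure ν] (hν : ∀ θ, IsFiniteMeasure (expTilt θ ν))
    (hμ : ∀ θ, mgf id μ θ = Real.exp ((expTilt θ ν).real univ - ν.real univ)) :
    μ = ENNReal.ofReal (Real.exp (-ν.real univ)) • convExp ν := by
  have hintegrable : integrableExpSet id μ = univ := eq_univ_of_forall fun θ => by
    by_contra hθ
    exact (Real.exp_pos _).ne ((mgf_undef hθ).symm.trans (hμ θ))
  have := Measure.smul_finite (convExp ν) (ENNReal.ofReal_ne_top (r := Real.exp (-ν.real univ)))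
  refine ext_of_mgf_id (by simp [hintegrable]) (funext fun θ => ?_)
  have := hν θ
  rw [hμ, mgf_id_eq_expTilt_real_univ, expTilt_smul, expTilt_convExp,
    measureReal_ennreal_smul_apply,
    measureReal_def (convExp _), convExp_univ, ENNReal.toReal_ofReal (by positivity),
    ENNReal.toReal_ofReal (by positivity), ← Real.exp_add, sub_eq_neg_add]

section Inversion

open scoped FourierTransform RealInnerProductSpace

theorem fourierInv_fourier_ae_eq {V E : Type*} [NormedAddCommGroup V] [InnerProductSpace ℝ V]
    [FiniteDimensional ℝ V] [MeasurableSpace V] [BorelSpace V] [NormedAddCommGroup E]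
    [NormedSpace ℂ E] [CompleteSpace E] {h : V → E} (h₁ : Integrable h)
    (h₂ : Integrable (𝓕 h)) : 𝓕⁻ (𝓕 h) =ᵐ[volume] h := by
  have hcont : Continuous (𝓕⁻ (𝓕 h)) := VectorFourier.fourierIntegral_continuous
    Real.continuous_fourierChar continuous_inner.neg h₂
  refine ae_eq_of_integral_contDiff_smul_eq hcont.locallyIntegrable h₁.locallyIntegrable
    fun φ hφ hφc => ?_
  have hcompact : HasCompactSupport (Complex.ofRealCLM ∘ φ) := hφc.comp_left rfl
  have hsmooth : ContDiff ℝ (↑(⊤ : ℕ∞)) (Complex.ofRealCLM ∘ φ) := by fun_prop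
  set ψ := hcompact.toSchwartzMap hsmooth
  set η : SchwartzMap V ℂ := 𝓕⁻ ψ
  have hself_adjoint_inv := VectorFourier.integral_fourierIntegral_smul_eq_flip (L := -innerₗ V)
    Real.continuous_fourierChar continuous_inner.neg ψ.integrable h₂ (μ := volume) (ν := volume)
  have hself_adjoint := VectorFourier.integral_fourierIntegral_smul_eq_flip (L := innerₗ V)
    Real.continuous_fourierChar continuous_inner η.integrable h₁ (μ := volume)
    (ν := volume)
  rw [show (-innerₗ V).flip = -innerₗ V by ext; simp [real_inner_comm]] at hself_adjoint_inv
  rw [flip_innerₗ] at hself_adjoint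
  have hη : 𝓕 ⇑η = ψ := by
    rw [← SchwartzMap.fourier_coe, FourierTransform.fourier_fourierInv_eq]
  have hη_eq : ⇑η = VectorFourier.fourierIntegral Real.fourierChar volume (-innerₗ V) ψ :=
    SchwartzMap.fourierInv_coe ψ
  simp only [← Complex.coe_smul]
  calc ∫ x, ψ x • 𝓕⁻ (𝓕 h) x = ∫ ξ, η ξ • 𝓕 h ξ := by
        rw [hη_eq]; exact hself_adjoint_inv.symm
    _ = ∫ x, 𝓕 ⇑η x • h x := hself_adjoint.symm
    _ = ∫ x, ψ x • h x := by rw [hη]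

theorem fourierInv_poissonRemainder (κ : Measure ℝ) (x : ℝ) :
    𝓕⁻ (fun ξ => poissonRemainder κ (-(2 * Real.pi) * ξ)) x =
      (2 * Real.pi : ℝ)⁻¹ * poissonInversion κ x := by
  have hscale := Measure.integral_comp_mul_left (fun t : ℝ =>
    Complex.exp (-(x * t : ℝ) * Complex.I) * poissonRemainder κ t) (-(2 * Real.pi))
  rw [abs_inv, abs_neg, abs_of_pos (by positivity : 0 < 2 * Real.pi), Complex.real_smul] at hscale
  rw [poissonInversion, ← hscale, Real.fourierInv_eq']
  refine integral_congr_ae (.of_forall fun ξ => ?_)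
  simp only [smul_eq_mul, RCLike.inner_apply, conj_trivial]
  congr 3
  push_cast
  ring

theorem continuous_poissonInversion {κ : Measure ℝ} [IsFiniteMeasure κ]
    (h₂ : Integrable fun t => ‖charFun κ t‖ ^ 2) : Continuous (poissonInversion κ) := by
  have hmeas := (continuous_poissonRemainder (κ := κ)).aestronglyMeasurable (μ := volume)
  refine continuous_of_dominated (fun x => by fun_prop)
    (fun x => .of_forall fun t => ?_) (integrable_poissonRemainder h₂).norm
    (.of_forall fun t => by fun_prop)
  rw [norm_mul, norm_cexp_neg_ofReal_mul_I, one_mul]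

theorem continuous_saddleRatio {κ : Measure ℝ} [IsFiniteMeasure κ]
    (h₂ : Integrable fun t => ‖charFun κ t‖ ^ 2) : Continuous (saddleRatio κ) := by
  have := continuous_poissonInversion h₂
  unfold saddleRatio
  fun_prop

variable {k : ℝ → ℝ} {f : ℝ → ℝ}

theorem integrable_of_isFiniteMeasure_measureOfDensity (hf : AEMeasurable f)
    (hf₀ : 0 ≤ᵐ[volume] f) [IsFiniteMeasure (measureOfDensity f)] : Integrable f := by
  simpa using (integrable_measureOfDensity_iff hf hf₀).1 (integrable_const (1 : ℝ))

theorem isFiniteMeasure_of_convExp_eq_dirac_add {ν ρ : Measure ℝ} [IsFiniteMeasure ν]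
    (h : convExp ν = Measure.dirac 0 + ρ) : IsFiniteMeasure ρ :=
  isFiniteMeasure_of_le (convExp ν) (h ▸ Measure.le_add_left le_rfl)

theorem fourier_sub_eq_poissonRemainder (hk₀ : 0 ≤ᵐ[volume] k) (hk₁ : Integrable k)
    (hf₀ : 0 ≤ᵐ[volume] f) (hf₁ : Integrable f)
    (h : convExp (measureOfDensity k) = Measure.dirac 0 + measureOfDensity f) (ξ : ℝ) :
    𝓕 (fun x => (f x : ℂ) - k x) ξ =
      poissonRemainder (measureOfDensity k) (-(2 * Real.pi) * ξ) := by
  have := isFiniteMeasure_measureOfDensity hk₁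
  have := isFiniteMeasure_measureOfDensity hf₁
  have hk₁' : Integrable fun x => (k x : ℂ) := hk₁.ofReal
  have hf₁' : Integrable fun x => (f x : ℂ) := hf₁.ofReal
  have hexp (t : ℝ) : Complex.exp (charFun (measureOfDensity k) t) =
      1 + charFun (measureOfDensity f) t := by
    have hint (μ : Measure ℝ) [IsFiniteMeasure μ] :
        Integrable (fun x : ℝ => Complex.exp (t * x * Complex.I)) μ :=
      .of_bound (by fun_prop) 1 (.of_forall fun x => by
        rw [← Complex.ofReal_mul, Complex.norm_exp_ofReal_mul_I])
    rw [← charFun_convExp, h, charFun_apply_real, integral_add_measure (hint _) (hint _),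
      integral_dirac, charFun_apply_real]
    simp
  have hξ : ξ = -(2 * Real.pi)⁻¹ * (-(2 * Real.pi) * ξ) := by field_simp
  have hsub : 𝓕 (fun x => (f x : ℂ) - k x) ξ =
      𝓕 (fun x => (f x : ℂ)) ξ - 𝓕 (fun x => (k x : ℂ)) ξ := by
    simp only [Real.fourier_eq, smul_sub]
    exact integral_sub ((Real.fourierIntegral_convergent_iff ξ).2 hf₁')
      ((Real.fourierIntegral_convergent_iff ξ).2 hk₁')
  rw [hsub, poissonRemainder, hexp, charFun_measureOfDensity hk₁.aemeasurable hk₀,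
    charFun_measureOfDensity hf₁.aemeasurable hf₀, ← hξ]
  ring

theorem ae_eq_of_convExp_eq_dirac_add (hk₀ : 0 ≤ᵐ[volume] k) (hk₁ : Integrable k)
    (hk₂ : MemLp k 2) (hf : AEMeasurable f) (hf₀ : 0 ≤ᵐ[volume] f)
    (h : convExp (measureOfDensity k) = Measure.dirac 0 + measureOfDensity f) :
    ∀ᵐ x, (f x : ℂ) =
      k x + (2 * Real.pi : ℝ)⁻¹ * poissonInversion (measureOfDensity k) x := by
  have := isFiniteMeasure_measureOfDensity hk₁
  have := isFiniteMeasure_of_convExp_eq_dirac_add h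
  have hf₁ := integrable_of_isFiniteMeasure_measureOfDensity hf hf₀
  have hk₁' : Integrable fun x => (k x : ℂ) := hk₁.ofReal
  have hf₁' : Integrable fun x => (f x : ℂ) := hf₁.ofReal
  have hfourier := funext (fourier_sub_eq_poissonRemainder hk₀ hk₁ hf₀ hf₁ h)
  have hint := (integrable_poissonRemainder (integrable_sq_norm_charFun hk₀ hk₁ hk₂)).comp_mul_left'
    (neg_ne_zero.2 (by positivity : 2 * Real.pi ≠ 0))
  rw [← hfourier] at hint
  filter_upwards [fourierInv_fourier_ae_eq (hf₁'.sub hk₁') hint] with x hx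
  rw [← fourierInv_poissonRemainder, ← hfourier]
  exact eq_add_of_sub_eq' hx.symm

theorem expTilt_measureOfDensity (hk : AEMeasurable k) (β : ℝ) :
    expTilt β (measureOfDensity k) = measureOfDensity fun x => Real.exp (β * x) * k x := by
  rw [expTilt, measureOfDensity, measureOfDensity, ← withDensity_mul₀ (by fun_prop) (by fun_prop)]
  refine withDensity_congr_ae (.of_forall fun x => ?_)
  simp only [Pi.mul_apply]
  rw [mul_comm, ENNReal.ofReal_mul (Real.exp_pos _).le]

theorem eqOn_of_convExp_eq_dirac_add (hk₀ : 0 ≤ᵐ[volume] k) (hk₁ : Integrable k)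
    (hk₂ : MemLp k 2) (hf : AEMeasurable f) (hf₀ : 0 ≤ᵐ[volume] f)
    (h : convExp (measureOfDensity k) = Measure.dirac 0 + measureOfDensity f) {U : Set ℝ}
    (hU : IsOpen U) (hkU : ∀ x ∈ U, k x = 0) (hfU : ContinuousOn f U) :
    EqOn (fun x => (f x : ℂ))
      (fun x => (2 * Real.pi : ℝ)⁻¹ * poissonInversion (measureOfDensity k) x) U := by
  have := isFiniteMeasure_measureOfDensity hk₁
  have hcont := continuous_poissonInversion (integrable_sq_norm_charFun hk₀ hk₁ hk₂)
  refine Measure.eqOn_open_of_ae_eq (μ := volume) ?_ hU (by fun_prop) (by fun_prop)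
  filter_upwards [ae_restrict_of_ae (ae_eq_of_convExp_eq_dirac_add hk₀ hk₁ hk₂ hf hf₀ h),
    ae_restrict_mem hU.measurableSet] with x hx hxU
  rw [hx, hkU x hxU, Complex.ofReal_zero, zero_add]

theorem exists_convExp_eq_dirac_add_measureOfDensity (hk₀ : 0 ≤ᵐ[volume] k)
    (hk₁ : Integrable k) (hk₂ : MemLp k 2) {U : Set ℝ} (hU : MeasurableSet U)
    (hkU : ∀ x ∈ U, k x = 0) :
    ∃ f : ℝ → ℝ, Measurable f ∧ (∀ x, 0 ≤ f x) ∧ ContinuousOn f U ∧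
      convExp (measureOfDensity k) = Measure.dirac 0 + measureOfDensity f := by
  classical
  have := isFiniteMeasure_measureOfDensity hk₁
  obtain ⟨ρ, hρ, hconv⟩ := exists_convExp_eq_dirac_add (measureOfDensity_absolutelyContinuous k)
  have := isFiniteMeasure_of_convExp_eq_dirac_add hconv
  set r : ℝ → ℝ := fun x => (ρ.rnDeriv volume x).toReal
  have hr : Measurable r := by fun_prop
  rw [← measureOfDensity_toReal_rnDeriv hρ] at hconv
  have hcont := continuous_poissonInversion (integrable_sq_norm_charFun hk₀ hk₁ hk₂)
  set q : ℝ → ℝ := fun x =>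
    max 0 ((2 * Real.pi)⁻¹ * (poissonInversion (measureOfDensity k) x).re)
  have hq : Continuous q := by fun_prop
  refine ⟨U.piecewise q r, hq.measurable.piecewise hU hr, fun x => ?_,
    hq.continuousOn.congr (piecewise_eqOn U q r), ?_⟩
  · by_cases hx : x ∈ U <;> simp [hx, q, r]
  · rw [hconv]
    refine congrArg _ (withDensity_congr_ae ?_)
    filter_upwards [ae_eq_of_convExp_eq_dirac_add hk₀ hk₁ hk₂ hr.aemeasurable
      (.of_forall fun x => ENNReal.toReal_nonneg) hconv] with x hx
    by_cases hxU : x ∈ U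
    · rw [hkU x hxU, Complex.ofReal_zero, zero_add] at hx
      have hre := congrArg Complex.re hx
      rw [Complex.ofReal_re, Complex.re_ofReal_mul] at hre
      have hr₀ : 0 ≤ r x := ENNReal.toReal_nonneg
      simp only [piecewise_eq_of_mem U q r hxU, q, ← hre, max_eq_right hr₀, r]
    · simp [hxU, r]

end Inversion

section TiltedMoments

variable {ν : Measure ℝ}

theorem expTilt_absolutelyContinuous (β : ℝ) (ν : Measure ℝ) : expTilt β ν ≪ ν :=
  withDensity_absolutelyContinuous _ _

theorem absolutelyContinuous_expTilt (β : ℝ) (ν : Measure ℝ) : ν ≪ expTilt β ν :=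
  withDensity_absolutelyContinuous' (by fun_prop)
    (.of_forall fun x => (ENNReal.ofReal_pos.2 (Real.exp_pos _)).ne')

theorem integral_expTilt {E : Type*} [NormedAddCommGroup E] [NormedSpace ℝ E] (β : ℝ)
    (φ : ℝ → E) : ∫ x, φ x ∂expTilt β ν = ∫ x, Real.exp (β * x) • φ x ∂ν := by
  rw [expTilt, integral_withDensity_eq_integral_toReal_smul (by fun_prop) (by simp)]
  simp only [ENNReal.toReal_ofReal (Real.exp_pos _).le]

theorem moment_id_expTilt (n : ℕ) (β : ℝ) :
    moment id n (expTilt β ν) = ∫ x, x ^ n * Real.exp (β * x) ∂ν := by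
  simp only [moment_id_eq_integral, integral_expTilt, smul_eq_mul, mul_comm]

variable [IsFiniteMeasure ν]

theorem isFiniteMeasure_expTilt (hν : ∀ᵐ x ∂ν, x ∈ Icc (0 : ℝ) 1) (β : ℝ) :
    IsFiniteMeasure (expTilt β ν) :=
  isFiniteMeasure_withDensity_ofReal
    (integrable_of_ae_mem_isCompact isCompact_Icc hν (by fun_prop)).2

theorem integrable_pow_mul_exp (hν : ∀ᵐ x ∂ν, x ∈ Icc (0 : ℝ) 1) (n : ℕ) (β : ℝ) :
    Integrable (fun x => x ^ n * Real.exp (β * x)) ν :=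
  integrable_of_ae_mem_isCompact isCompact_Icc hν (by fun_prop)

theorem hasDerivAt_moment_id_expTilt (hν : ∀ᵐ x ∂ν, x ∈ Icc (0 : ℝ) 1) (n : ℕ) (β : ℝ) :
    HasDerivAt (fun θ => moment id n (expTilt θ ν)) (moment id (n + 1) (expTilt β ν)) β := by
  have hintegrable : integrableExpSet id ν = univ := eq_univ_of_forall fun θ =>
    integrable_of_ae_mem_isCompact isCompact_Icc hν (by simp only [id]; fun_prop)
  simp only [moment_id_expTilt]
  exact hasDerivAt_integral_pow_mul_exp_real (X := id) (by simp [hintegrable]) n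

theorem pow_mul_real_Ici_le_moment_id (hν : ∀ᵐ x ∂ν, x ∈ Icc (0 : ℝ) 1) {a : ℝ} (ha : 0 ≤ a)
    (n : ℕ) : a ^ n * ν.real (Ici a) ≤ moment id n ν := by
  refine le_trans ?_ (mul_meas_ge_le_integral_of_nonneg
    (hν.mono fun x hx => pow_nonneg hx.1 n) (integrable_pow hν n) (a ^ n))
  gcongr
  · finiteness
  · exact fun x (hx : a ≤ x) => pow_le_pow_left₀ ha hx n

theorem exp_mul_real_Ici_le_expTilt_real_Ici (hν : ∀ᵐ x ∂ν, x ∈ Icc (0 : ℝ) 1) (a : ℝ) {β : ℝ}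
    (hβ : 0 ≤ β) : Real.exp (β * a) * ν.real (Ici a) ≤ (expTilt β ν).real (Ici a) := by
  have := isFiniteMeasure_expTilt hν β
  rw [← ENNReal.toReal_ofReal (Real.exp_pos (β * a)).le, Measure.real, ← ENNReal.toReal_mul]
  refine ENNReal.toReal_mono (by finiteness) ?_
  rw [expTilt, withDensity_apply _ measurableSet_Ici, ← setLIntegral_const]
  exact setLIntegral_mono (by fun_prop) fun x (hx : a ≤ x) => by gcongr

theorem pow_mul_exp_mul_le_moment_id_expTilt (hν : ∀ᵐ x ∂ν, x ∈ Icc (0 : ℝ) 1) {a β : ℝ}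
    (ha : 0 ≤ a) (hβ : 0 ≤ β) (n : ℕ) :
    a ^ n * (Real.exp (β * a) * ν.real (Ici a)) ≤ moment id n (expTilt β ν) := by
  have := isFiniteMeasure_expTilt hν β
  exact (mul_le_mul_of_nonneg_left (exp_mul_real_Ici_le_expTilt_real_Ici hν a hβ)
    (pow_nonneg ha n)).trans
    (pow_mul_real_Ici_le_moment_id ((expTilt_absolutelyContinuous β ν).ae_le hν) ha n)

theorem moment_id_expTilt_pos (hν : ∀ᵐ x ∂ν, x ∈ Icc (0 : ℝ) 1) {a : ℝ} (ha : 0 < a)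
    (hνa : ν (Ici a) ≠ 0) (n : ℕ) (β : ℝ) : 0 < moment id n (expTilt β ν) := by
  have := isFiniteMeasure_expTilt hν β
  have hmass : expTilt β ν (Ici a) ≠ 0 := fun h => hνa (absolutelyContinuous_expTilt β ν h)
  exact (mul_pos (pow_pos ha n) (ENNReal.toReal_pos hmass (by finiteness))).trans_le
    (pow_mul_real_Ici_le_moment_id ((expTilt_absolutelyContinuous β ν).ae_le hν) ha.le n)

theorem strictMono_moment_id_expTilt (hν : ∀ᵐ x ∂ν, x ∈ Icc (0 : ℝ) 1) {a : ℝ} (ha : 0 < a)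
    (hνa : ν (Ici a) ≠ 0) (n : ℕ) : StrictMono fun β => moment id n (expTilt β ν) :=
  strictMono_of_hasDerivAt_pos (hasDerivAt_moment_id_expTilt hν n)
    (moment_id_expTilt_pos hν ha hνa (n + 1))

theorem tendsto_moment_id_expTilt_atTop (hν : ∀ᵐ x ∂ν, x ∈ Icc (0 : ℝ) 1) {a : ℝ} (ha : 0 < a)
    (hνa : ν (Ici a) ≠ 0) (n : ℕ) :
    Tendsto (fun β => moment id n (expTilt β ν)) atTop atTop := by
  have hmass : 0 < ν.real (Ici a) := ENNReal.toReal_pos hνa (by finiteness)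
  have hexp : Tendsto (fun β => Real.exp (β * a)) atTop atTop :=
    Real.tendsto_exp_atTop.comp (tendsto_id.atTop_mul_const ha)
  refine tendsto_atTop_mono' _ ?_
    ((hexp.atTop_mul_const hmass).const_mul_atTop (pow_pos ha n))
  filter_upwards [eventually_ge_atTop 0] with β hβ
  exact pow_mul_exp_mul_le_moment_id_expTilt hν ha.le hβ n

theorem tendsto_moment_id_succ_expTilt_atBot (hν : ∀ᵐ x ∂ν, x ∈ Icc (0 : ℝ) 1) (n : ℕ) :
    Tendsto (fun β => moment id (n + 1) (expTilt β ν)) atBot (𝓝 0) := by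
  simp only [moment_id_expTilt]
  rw [← integral_zero ℝ ℝ (μ := ν)]
  refine tendsto_integral_filter_of_dominated_convergence (fun _ => 1)
    (.of_forall fun β => by fun_prop) ?_ (integrable_const _) (hν.mono fun x hx => ?_)
  · filter_upwards [eventually_le_atBot 0] with β hβ
    filter_upwards [hν] with x hx
    rw [Real.norm_of_nonneg (mul_nonneg (pow_nonneg hx.1 _) (Real.exp_pos _).le)]
    exact mul_le_one₀ (pow_le_one₀ hx.1 hx.2) (Real.exp_pos _).le
      (Real.exp_le_one_iff.2 (mul_nonpos_of_nonpos_of_nonneg hβ hx.1))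
  · rcases hx.1.eq_or_lt with rfl | hx₀
    · simp
    · have hexp : Tendsto (fun β => Real.exp (β * x)) atBot (𝓝 0) :=
        Real.tendsto_exp_atBot.comp (tendsto_id.atBot_mul_const hx₀)
      simpa using hexp.const_mul (x ^ (n + 1))

theorem existsUnique_moment_id_succ_expTilt_eq (hν : ∀ᵐ x ∂ν, x ∈ Icc (0 : ℝ) 1) {a : ℝ}
    (ha : 0 < a) (hνa : ν (Ici a) ≠ 0) (n : ℕ) {u : ℝ} (hu : 0 < u) :
    ∃! β, moment id (n + 1) (expTilt β ν) = u := by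
  have hcont : Continuous fun β => moment id (n + 1) (expTilt β ν) :=
    continuous_iff_continuousAt.2 fun β => (hasDerivAt_moment_id_expTilt hν _ β).continuousAt
  obtain ⟨β, hβ⟩ := mem_range_of_exists_le_of_exists_ge hcont
    ((tendsto_moment_id_succ_expTilt_atBot hν n).eventually_le_const hu).exists
    ((tendsto_moment_id_expTilt_atTop hν ha hνa (n + 1)).eventually_ge_atTop u).exists
  exact ⟨β, hβ, fun θ hθ => (strictMono_moment_id_expTilt hν ha hνa (n + 1)).injective
    (hθ.trans hβ.symm)⟩

theorem re_charFun_expTilt_le (hν : ∀ᵐ x ∂ν, x ∈ Icc (0 : ℝ) 1) {a β c t : ℝ} (hβ : 0 ≤ β)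
    (hc : (charFun (ν.restrict (Ici a)) t).re ≤ moment id 0 (ν.restrict (Ici a)) - c) :
    (charFun (expTilt β ν) t).re ≤ moment id 0 (expTilt β ν) - c * Real.exp (β * a) := by
  have := isFiniteMeasure_expTilt hν β
  have hcos (μ : Measure ℝ) [IsFiniteMeasure μ] : Integrable (fun x => Real.cos (t * x)) μ :=
    .of_bound (by fun_prop) 1 (.of_forall fun x => Real.abs_cos_le_one _)
  have hdeficit (μ : Measure ℝ) [IsFiniteMeasure μ] :
      moment id 0 μ - (charFun μ t).re = ∫ x, (1 - Real.cos (t * x)) ∂μ := by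
    rw [integral_sub (integrable_const 1) (hcos μ), re_charFun, moment_id_zero]
    simp
  have hintegrable : Integrable (fun x => Real.exp (β * x) * (1 - Real.cos (t * x))) ν :=
    integrable_of_ae_mem_isCompact isCompact_Icc hν (by fun_prop)
  have hnonneg (x : ℝ) : 0 ≤ 1 - Real.cos (t * x) := sub_nonneg.2 (Real.cos_le_one _)
  suffices c * Real.exp (β * a) ≤ moment id 0 (expTilt β ν) - (charFun (expTilt β ν) t).re by
    linarith
  calc c * Real.exp (β * a)
      ≤ (∫ x in Ici a, (1 - Real.cos (t * x)) ∂ν) * Real.exp (β * a) := by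
        rw [← hdeficit]; gcongr; linarith
    _ = ∫ x in Ici a, Real.exp (β * a) * (1 - Real.cos (t * x)) ∂ν := by
        rw [integral_const_mul, mul_comm]
    _ ≤ ∫ x in Ici a, Real.exp (β * x) * (1 - Real.cos (t * x)) ∂ν :=
        setIntegral_mono_on (((integrable_const 1).sub (hcos _)).const_mul _)
          hintegrable.integrableOn measurableSet_Ici fun x (hx : a ≤ x) => by
            gcongr; exact hnonneg x
    _ ≤ ∫ x, Real.exp (β * x) * (1 - Real.cos (t * x)) ∂ν :=
        setIntegral_le_integral hintegrable
          (.of_forall fun x => mul_nonneg (Real.exp_pos _).le (hnonneg x))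
    _ = moment id 0 (expTilt β ν) - (charFun (expTilt β ν) t).re := by
        rw [hdeficit, integral_expTilt]; rfl

theorem mul_moment_one_expTilt_sub_le_moment_two (hν : ∀ᵐ x ∂ν, x ∈ Icc (0 : ℝ) 1) {b β : ℝ}
    (hb : 0 ≤ b) (hβ : 0 ≤ β) :
    b * moment id 1 (expTilt β ν) - b ^ 2 * Real.exp (β * b) * ν.real univ ≤
      moment id 2 (expTilt β ν) := by
  have hpointwise {x : ℝ} (hx : 0 ≤ x) : b * (x ^ 1 * Real.exp (β * x)) - b ^ 2 * Real.exp (β * b) ≤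
      x ^ 2 * Real.exp (β * x) := by
    rcases le_total b x with h | h
    · have : b * x * Real.exp (β * x) ≤ x * x * Real.exp (β * x) := by gcongr
      nlinarith [Real.exp_pos (β * b), sq_nonneg b]
    · have : b * x * Real.exp (β * x) ≤ b * b * Real.exp (β * b) := by gcongr
      nlinarith [Real.exp_pos (β * x), sq_nonneg x]
  have hint := (integrable_pow_mul_exp hν 1 β).const_mul b
  have hmono := integral_mono_ae (hint.sub (integrable_const (b ^ 2 * Real.exp (β * b))))
    (integrable_pow_mul_exp hν 2 β) (hν.mono fun x hx => hpointwise hx.1)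
  simp only [Pi.sub_apply] at hmono
  rw [integral_sub hint (integrable_const _), integral_const_mul, integral_const,
    smul_eq_mul, mul_comm (ν.real univ)] at hmono
  simpa only [moment_id_expTilt] using hmono

theorem eventually_mul_moment_one_le_moment_two_expTilt (hν : ∀ᵐ x ∂ν, x ∈ Icc (0 : ℝ) 1)
    {a : ℝ} (ha : 0 < a) (hνa : ν (Ici a) ≠ 0) :
    ∀ᶠ β in atTop, a / 4 * moment id 1 (expTilt β ν) ≤ moment id 2 (expTilt β ν) := by
  have hmass : 0 < ν.real (Ici a) := ENNReal.toReal_pos hνa (by finiteness)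
  have hexp : Tendsto (fun β => Real.exp (β * (a / 2)) * ν.real (Ici a)) atTop atTop :=
    (Real.tendsto_exp_atTop.comp (tendsto_id.atTop_mul_const (half_pos ha))).atTop_mul_const hmass
  filter_upwards [eventually_ge_atTop 0, hexp.eventually_ge_atTop (ν.real univ)] with β hβ hβν
  have hlower := pow_mul_exp_mul_le_moment_id_expTilt hν ha.le hβ 1
  have hsplit : Real.exp (β * a) = Real.exp (β * (a / 2)) * Real.exp (β * (a / 2)) := by
    rw [← Real.exp_add]; ring_nf
  have herror : a * (Real.exp (β * (a / 2)) * ν.real univ) ≤ moment id 1 (expTilt β ν) := by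
    refine le_trans ?_ hlower
    rw [pow_one, hsplit, mul_assoc (Real.exp _)]
    gcongr
  nlinarith [mul_moment_one_expTilt_sub_le_moment_two hν (half_pos ha).le hβ]

theorem moment_zero_expTilt_le (hν : ∀ᵐ x ∂ν, x ∈ Icc (0 : ℝ) 1) {β : ℝ} (hβ : 0 ≤ β) :
    moment id 0 (expTilt β ν) ≤ ν.real univ * Real.exp β := by
  have hmono := integral_mono_ae (integrable_pow_mul_exp hν 0 β)
    (integrable_const (Real.exp β)) (hν.mono fun x hx => ?_)
  · rwa [← moment_id_expTilt, integral_const, smul_eq_mul] at hmono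
  · simp only [pow_zero, one_mul]
    exact Real.exp_le_exp.2 (mul_le_of_le_one_right hβ hx.2)

end TiltedMoments

section TiltedLimit

theorem tendsto_exp_pow_mul_exp_neg_mul_exp {a c : ℝ} (ha : 0 < a) (hc : 0 < c) (n : ℕ) :
    Tendsto (fun β => Real.exp β ^ n * Real.exp (-(c * Real.exp (β * a)))) atTop (𝓝 0) := by
  have hexp : Tendsto (fun β => Real.exp (β * a)) atTop atTop :=
    Real.tendsto_exp_atTop.comp (tendsto_id.atTop_mul_const ha)
  refine ((tendsto_rpow_mul_exp_neg_mul_atTop_nhds_zero (n / a) c hc).comp hexp).congr fun β => ?_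
  rw [Function.comp_apply, ← Real.exp_mul, ← Real.exp_nat_mul, neg_mul]
  congr 2
  field_simp

theorem sqrt_mul_mul_le_inv {s m I Λ L E D : ℝ} (hs : 1 ≤ s) (hsm : s ≤ m) (hm : m ≤ Λ * E)
    (hE : 1 ≤ E) (hI₀ : 0 ≤ I) (hI : I ≤ L * E ^ 2) (hD : 0 ≤ D)
    (hdecay : Λ ^ 2 * (2 * (1 + Λ) + 3 * L) * (E ^ 4 * D) ≤ 1) :
    √s * (D * (2 * (1 + m) + 3 * I)) ≤ s⁻¹ := by
  have hs₀ : 0 < s := one_pos.trans_le hs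
  have hsum₀ : 0 ≤ 2 * (1 + m) + 3 * I := by linarith
  have hsqrt : √s * s ≤ (Λ * E) ^ 2 := by
    have : √s ≤ s := Real.sqrt_le_self_iff.2 (.inr hs)
    nlinarith
  have hsum : 2 * (1 + m) + 3 * I ≤ (2 * (1 + Λ) + 3 * L) * E ^ 2 := by
    have hΛ : 0 ≤ Λ := by
      refine nonneg_of_mul_nonneg_left ?_ (one_pos.trans_le hE)
      linarith
    nlinarith [mul_le_mul_of_nonneg_left hE hΛ]
  rw [← one_div, le_div_iff₀ hs₀]
  calc √s * (D * (2 * (1 + m) + 3 * I)) * s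
      = √s * s * (2 * (1 + m) + 3 * I) * D := by ring
    _ ≤ (Λ * E) ^ 2 * ((2 * (1 + Λ) + 3 * L) * E ^ 2) * D := by gcongr
    _ = Λ ^ 2 * (2 * (1 + Λ) + 3 * L) * (E ^ 4 * D) := by ring
    _ ≤ 1 := hdecay

/-- `k` is a square integrable function on the real line that is nonnegative and vanishes outside
`[0, 1]`; it is used as the density of the Lévy measure and of its exponential tilts. -/
structure IsUnitLevyDensity (k : ℝ → ℝ) : Prop where
  nonneg : 0 ≤ᵐ[volume] k
  memLp_two : MemLp k 2
  eq_zero : ∀ x ∉ Icc (0 : ℝ) 1, k x = 0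

namespace IsUnitLevyDensity

variable {k : ℝ → ℝ} (h : IsUnitLevyDensity k)
include h

theorem integrable : Integrable k := by
  rw [← integrableOn_iff_integrable_of_support_subset (Function.support_subset_iff'.2 h.eq_zero)]
  exact (h.memLp_two.restrict _).integrable one_le_two

theorem isFiniteMeasure : IsFiniteMeasure (measureOfDensity k) :=
  isFiniteMeasure_measureOfDensity h.integrable

theorem ae_mem_Icc : ∀ᵐ x ∂measureOfDensity k, x ∈ Icc (0 : ℝ) 1 := by
  rw [measureOfDensity, ae_withDensity_iff' h.integrable.aemeasurable.ennreal_ofReal]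
  refine .of_forall fun x hx => ?_
  by_contra hx'
  simp [h.eq_zero x hx'] at hx

theorem norm_exp_mul_le (β x : ℝ) :
    ‖Real.exp (β * x) * k x‖ ≤ Real.exp |β| * ‖k x‖ := by
  by_cases hx : x ∈ Icc (0 : ℝ) 1
  · rw [norm_mul, Real.norm_of_nonneg (Real.exp_pos _).le]
    gcongr
    calc β * x ≤ |β| * x := mul_le_mul_of_nonneg_right (le_abs_self β) hx.1
      _ ≤ |β| := mul_le_of_le_one_right (abs_nonneg β) hx.2
  · simp [h.eq_zero x hx]

theorem exp_mul (β : ℝ) : IsUnitLevyDensity fun x => Real.exp (β * x) * k x where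
  nonneg := h.nonneg.mono fun x hx => mul_nonneg (Real.exp_pos _).le hx
  memLp_two := h.memLp_two.of_le_mul
    (((by fun_prop : Continuous fun x => Real.exp (β * x)).aestronglyMeasurable).mul
      h.memLp_two.1) (.of_forall (h.norm_exp_mul_le β))
  eq_zero x hx := by rw [h.eq_zero x hx, mul_zero]

theorem expTilt_eq (β : ℝ) : expTilt β (measureOfDensity k) =
    measureOfDensity fun x => Real.exp (β * x) * k x :=
  expTilt_measureOfDensity h.integrable.aemeasurable β

theorem integrable_sq_norm_charFun_expTilt (β : ℝ) :
    Integrable fun t => ‖charFun (expTilt β (measureOfDensity k)) t‖ ^ 2 := by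
  rw [h.expTilt_eq]
  exact integrable_sq_norm_charFun (h.exp_mul β).nonneg (h.exp_mul β).integrable
    (h.exp_mul β).memLp_two

theorem integral_sq_norm_charFun_expTilt_le {β : ℝ} (hβ : 0 ≤ β) :
    ∫ t, ‖charFun (expTilt β (measureOfDensity k)) t‖ ^ 2 ≤
      2 * Real.pi * (∫ x, k x ^ 2) * Real.exp β ^ 2 := by
  have hpointwise (x : ℝ) : (Real.exp (β * x) * k x) ^ 2 ≤ Real.exp β ^ 2 * k x ^ 2 := by
    have hle := h.norm_exp_mul_le β x
    rw [abs_of_nonneg hβ] at hle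
    simpa only [mul_pow, Real.norm_eq_abs, sq_abs] using
      pow_le_pow_left₀ (norm_nonneg _) hle 2
  rw [h.expTilt_eq, integral_sq_norm_charFun (h.exp_mul β).nonneg (h.exp_mul β).integrable
    (h.exp_mul β).memLp_two, mul_assoc (2 * Real.pi), mul_comm (∫ x, k x ^ 2),
    ← integral_const_mul (Real.exp β ^ 2)]
  exact mul_le_mul_of_nonneg_left (integral_mono (h.exp_mul β).memLp_two.integrable_sq
    (h.memLp_two.integrable_sq.const_mul _) hpointwise) (by positivity : 0 ≤ 2 * Real.pi)

theorem exists_Ici_ne_zero (hk : measureOfDensity k ≠ 0) :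
    ∃ a : ℝ, 0 < a ∧ measureOfDensity k (Ici a) ≠ 0 := by
  have hIoi : measureOfDensity k (⋃ n : ℕ, Ici (1 / ((n : ℝ) + 1))) ≠ 0 := fun hzero => by
    refine hk (ae_eq_bot.1 (eventually_false_iff_eq_bot.1 ?_))
    filter_upwards [h.ae_mem_Icc, measure_eq_zero_iff_ae_notMem.1 hzero,
      (measureOfDensity_absolutelyContinuous k).ae_le (volume.ae_ne 0)] with x hx hx' hx₀
    obtain ⟨n, hn⟩ := exists_nat_one_div_lt (hx.1.lt_of_ne' hx₀)
    exact hx' (mem_iUnion.2 ⟨n, hn.le⟩)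
  obtain ⟨n, hn⟩ := exists_measure_pos_of_not_measure_iUnion_null hIoi
  exact ⟨1 / ((n : ℝ) + 1), by positivity, hn.ne'⟩

theorem eventually_norm_saddleRatio_sub_one_le (hk : measureOfDensity k ≠ 0) :
    ∀ᶠ β in atTop, ∀ v, 0 ≤ v → ‖saddleRatio (expTilt β (measureOfDensity k)) v - 1‖ ≤
      6 * v / √(moment id 2 (expTilt β (measureOfDensity k))) +
        18601 / moment id 2 (expTilt β (measureOfDensity k)) := by
  have := h.isFiniteMeasure
  obtain ⟨a, ha, hka⟩ := h.exists_Ici_ne_zero hk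
  set ν := measureOfDensity k
  obtain ⟨c, ⟨hc₀, hcν⟩, hc⟩ := exists_re_charFun_le (ν := ν.restrict (Ici a))
    (Measure.absolutelyContinuous_of_le Measure.restrict_le_self |>.trans
      (measureOfDensity_absolutelyContinuous k)) (by simpa using hka)
  set B := ν.real univ ^ 2 * (2 * (1 + ν.real univ) + 3 * (2 * Real.pi * ∫ x, k x ^ 2))
  have hdecay := (tendsto_exp_pow_mul_exp_neg_mul_exp ha hc₀ 4).const_mul B
  rw [mul_zero] at hdecay
  filter_upwards [eventually_ge_atTop 0, hdecay.eventually_le_const zero_lt_one,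
    (tendsto_moment_id_expTilt_atTop h.ae_mem_Icc ha hka 2).eventually_ge_atTop 1]
    with β hβ hβ_decay hs v hv
  have := isFiniteMeasure_expTilt h.ae_mem_Icc β
  have hκ := (expTilt_absolutelyContinuous β ν).ae_le h.ae_mem_Icc
  have hδ₀ : c * Real.exp (β * a) ≤ moment id 0 (expTilt β ν) := by
    rw [moment_id_zero, measureReal_restrict_apply_univ] at hcν
    calc c * Real.exp (β * a) ≤ ν.real (Ici a) * Real.exp (β * a) := by gcongr
      _ = a ^ 0 * (Real.exp (β * a) * ν.real (Ici a)) := by ring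
      _ ≤ _ := pow_mul_exp_mul_le_moment_id_expTilt h.ae_mem_Icc ha.le hβ 0
  have hratio := norm_saddleRatio_sub_one_le hκ hs hδ₀
    (fun t ht => re_charFun_expTilt_le h.ae_mem_Icc hβ (hc t ht))
    (h.integrable_sq_norm_charFun_expTilt β) hv
  have htail := sqrt_mul_mul_le_inv hs (moment_id_antitone hκ zero_le_two)
    (moment_zero_expTilt_le h.ae_mem_Icc hβ) (Real.one_le_exp hβ)
    (integral_nonneg fun t => sq_nonneg _) (h.integral_sq_norm_charFun_expTilt_le hβ)
    (Real.exp_pos _).le hβ_decay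
  exact hratio.trans ((add_le_add_right htail _).trans_eq (by ring))

end IsUnitLevyDensity

end TiltedLimit

section LaplaceIntegral

variable {β : ℝ} (hβ : 0 < β)
include hβ

theorem integral_exp_neg_mul_Ioi : ∫ v in Ioi (0 : ℝ), Real.exp (-(β * v)) = β⁻¹ := by
  simpa using Real.integral_rpow_mul_exp_neg_mul_Ioi one_pos hβ

theorem integral_mul_exp_neg_mul_Ioi :
    ∫ v in Ioi (0 : ℝ), v * Real.exp (-(β * v)) = (β ^ 2)⁻¹ := by
  have h := Real.integral_rpow_mul_exp_neg_mul_Ioi two_pos hβ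
  norm_num at h
  exact h

theorem abs_integral_exp_neg_mul_mul_sub_inv_le {J : ℝ → ℝ} {b c : ℝ}
    (hJ : AEStronglyMeasurable J (volume.restrict (Ioi 0)))
    (hbound : ∀ v ∈ Ioi (0 : ℝ), |J v - 1| ≤ b * v + c) :
    |(∫ v in Ioi (0 : ℝ), Real.exp (-(β * v)) * J v) - β⁻¹| ≤ b / β ^ 2 + c / β := by
  have hexp : IntegrableOn (fun v => Real.exp (-(β * v))) (Ioi 0) :=
    .of_integral_ne_zero (by rw [integral_exp_neg_mul_Ioi hβ]; positivity)
  have hmul : IntegrableOn (fun v => v * Real.exp (-(β * v))) (Ioi 0) :=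
    .of_integral_ne_zero (by rw [integral_mul_exp_neg_mul_Ioi hβ]; positivity)
  have hmajorant := (hmul.const_mul b).add (hexp.const_mul c)
  have hle : ∀ᵐ v ∂volume.restrict (Ioi (0 : ℝ)), ‖Real.exp (-(β * v)) * (J v - 1)‖ ≤
      b * (v * Real.exp (-(β * v))) + c * Real.exp (-(β * v)) := by
    filter_upwards [ae_restrict_mem measurableSet_Ioi] with v hv
    rw [norm_mul, Real.norm_of_nonneg (Real.exp_pos _).le, Real.norm_eq_abs]
    exact (mul_le_mul_of_nonneg_left (hbound v hv) (Real.exp_pos _).le).trans_eq (by ring)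
  have hdiff : IntegrableOn (fun v => Real.exp (-(β * v)) * (J v - 1)) (Ioi 0) :=
    hmajorant.mono' (AEStronglyMeasurable.mul
      (by fun_prop : Continuous fun v => Real.exp (-(β * v))).aestronglyMeasurable
      (hJ.sub aestronglyMeasurable_const)) hle
  have hsplit : (∫ v in Ioi (0 : ℝ), Real.exp (-(β * v)) * J v) - β⁻¹ =
      ∫ v in Ioi (0 : ℝ), Real.exp (-(β * v)) * (J v - 1) := by
    rw [sub_eq_iff_eq_add, ← integral_exp_neg_mul_Ioi hβ, ← integral_add hdiff hexp]
    exact integral_congr_ae (.of_forall fun v => by ring)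
  rw [hsplit, ← Real.norm_eq_abs]
  refine (norm_integral_le_of_norm_le hmajorant hle).trans_eq ?_
  rw [integral_add' (hmul.const_mul b) (hexp.const_mul c), integral_const_mul, integral_const_mul,
    integral_exp_neg_mul_Ioi hβ, integral_mul_exp_neg_mul_Ioi hβ]
  ring

end LaplaceIntegral

namespace EqMulOneAddBigO

variable {F G M e : ℝ → ℝ}

theorem trans_isBigO (h : EqMulOneAddBigO F M e) {e' : ℝ → ℝ} (he : e =O[atTop] e') :
    EqMulOneAddBigO F M e' :=
  let ⟨r, hr, hF⟩ := h
  ⟨r, hr.trans he, hF⟩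

theorem mul_left (h : EqMulOneAddBigO F M e) (a : ℝ → ℝ) :
    EqMulOneAddBigO (fun u => a u * F u) (fun u => a u * M u) e :=
  let ⟨r, hr, hF⟩ := h
  ⟨r, hr, hF.mono fun u hu => by simp only [hu, mul_assoc]⟩

theorem of_common_main_term (hF : EqMulOneAddBigO F M e) (hG : EqMulOneAddBigO G M e)
    (he : Tendsto e atTop (𝓝 0)) : EqMulOneAddBigO F G e := by
  obtain ⟨r, hr, hF⟩ := hF
  obtain ⟨q, hq, hG⟩ := hG
  have hq₀ := hq.trans_tendsto he
  have hq₁ : Tendsto (fun u => 1 + q u) atTop (𝓝 1) := by simpa using hq₀.const_add 1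
  refine ⟨fun u => (r u - q u) * (1 + q u)⁻¹, ?_, ?_⟩
  · simpa using (hr.sub hq).mul ((hq₁.inv₀ one_ne_zero).isBigO_one ℝ)
  · filter_upwards [hF, hG, hq₁.eventually_ne one_ne_zero] with u hFu hGu hqu
    rw [hFu, hGu]
    field_simp
    ring

end EqMulOneAddBigO

section CompoundPoisson

variable {ν : Measure ℝ} {f : ℝ → ℝ}

theorem convExp_singleton_zero [SFinite ν] (hν : ν ≪ volume) : convExp ν {0} = 1 := by
  obtain ⟨ρ, hρ, h⟩ := exists_convExp_eq_dirac_add hν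
  rw [h, Measure.add_apply, hρ (measure_singleton 0), add_zero]
  simp

theorem measureOfDensity_const_mul {c : ℝ} (hc : 0 ≤ c) (f : ℝ → ℝ) :
    measureOfDensity (fun x => c * f x) = ENNReal.ofReal c • measureOfDensity f := by
  rw [measureOfDensity, measureOfDensity, ← withDensity_smul' _ _ ENNReal.ofReal_ne_top]
  exact congrArg _ (funext fun x => ENNReal.ofReal_mul hc)

theorem convExp_expTilt_eq_dirac_add [SFinite ν] (hf : AEMeasurable f)
    (h : convExp ν = Measure.dirac 0 + measureOfDensity f) (β : ℝ) :
    convExp (expTilt β ν) =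
      Measure.dirac 0 + measureOfDensity fun x => Real.exp (β * x) * f x := by
  rw [← expTilt_convExp, h, ← expTilt_measureOfDensity hf, ← expTilt_dirac_zero β]
  nth_rw 1 [expTilt_dirac_zero]
  exact withDensity_add_measure _ _ _

variable {Ω : Type*} [MeasurableSpace Ω] {T : Ω → ℝ} {P : Measure Ω} {c : ℝ}

theorem isDefectiveDensity_const_mul [SFinite ν] (hν : ν ≪ volume) (hc : 0 ≤ c)
    (hT : P.map T = ENNReal.ofReal c • convExp ν) (hf : Measurable f) (hf₀ : ∀ x, 0 ≤ f x)
    (hfc : ContinuousOn f (Ioi 1)) (h : convExp ν = Measure.dirac 0 + measureOfDensity f) :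
    IsDefectiveDensity T P fun x => c * f x where
  measurable := hf.const_mul c
  nonneg x := mul_nonneg hc (hf₀ x)
  law_eq := by
    rw [hT, Measure.smul_apply, convExp_singleton_zero hν, smul_eq_mul, mul_one]
    exact (congrArg _ h).trans
      ((smul_add _ _ _).trans (congrArg _ (measureOfDensity_const_mul hc f).symm))
  continuousOn := hfc.const_mul c

theorem IsDefectiveDensity.convExp_eq_dirac_add [SFinite ν] (hf : IsDefectiveDensity T P f)
    (hν : ν ≪ volume) (hc : 0 < c) (hT : P.map T = ENNReal.ofReal c • convExp ν) :
    convExp ν = Measure.dirac 0 + measureOfDensity fun x => c⁻¹ * f x := by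
  have hlaw : ENNReal.ofReal c • convExp ν =
      ENNReal.ofReal c • Measure.dirac 0 + measureOfDensity f := by
    have hlaw := hf.law_eq
    rwa [hT, Measure.smul_apply, convExp_singleton_zero hν, smul_eq_mul, mul_one] at hlaw
  have hcancel : ENNReal.ofReal c⁻¹ * ENNReal.ofReal c = 1 := by
    rw [← ENNReal.ofReal_mul (by positivity), inv_mul_cancel₀ hc.ne', ENNReal.ofReal_one]
  rw [measureOfDensity_const_mul (by positivity), ← one_smul ENNReal (convExp ν), ← hcancel,
    mul_smul, hlaw, smul_add, smul_smul, hcancel, one_smul]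

theorem IsDefectiveDensity.measureReal_Ici (hf : IsDefectiveDensity T P f)
    (hT : AEMeasurable T P) {u : ℝ} (hu : 0 < u) :
    P.real {ω | u ≤ T ω} = ∫ v in Ioi (0 : ℝ), f (u + v) := by
  have hfm := hf.measurable
  have hlaw : P.map T (Ici u) = ∫⁻ x in Ici u, ENNReal.ofReal (f x) := by
    rw [hf.law_eq, Measure.add_apply, Measure.smul_apply, Measure.dirac_apply' _ measurableSet_Ici,
      indicator_of_notMem (by simpa using hu), smul_zero, zero_add,
      withDensity_apply _ measurableSet_Ici]
  calc P.real {ω | u ≤ T ω} = (P.map T).real (Ici u) :=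
        (map_measureReal_apply_of_aemeasurable hT measurableSet_Ici).symm
    _ = ∫ x in Ioi u, f x := by
        rw [Measure.real, hlaw, ← integral_Ici_eq_integral_Ioi,
          integral_eq_lintegral_of_nonneg_ae (.of_forall hf.nonneg) (by fun_prop)]
    _ = ∫ v in Ioi (0 : ℝ), f (u + v) := by
        rw [← integral_indicator measurableSet_Ioi, ← integral_indicator measurableSet_Ioi,
          ← integral_add_left_eq_self _ u]
        refine integral_congr_ae (.of_forall fun v => ?_)
        simp only [indicator, mem_Ioi, lt_add_iff_pos_right]

end CompoundPoisson

section TiltedInversion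

namespace IsUnitLevyDensity

variable {k f : ℝ → ℝ} (h : IsUnitLevyDensity k)
include h

theorem exp_mul_density_eq (hf : AEMeasurable f) (hf₀ : 0 ≤ᵐ[volume] f)
    (hfc : ContinuousOn f (Ioi 1))
    (hconv : convExp (measureOfDensity k) = Measure.dirac 0 + measureOfDensity f) (β : ℝ) {x : ℝ}
    (hx : 1 < x) : Real.exp (β * x) * f x =
      (2 * Real.pi)⁻¹ * (poissonInversion (expTilt β (measureOfDensity k)) x).re := by
  have := h.isFiniteMeasure
  have htilt := convExp_expTilt_eq_dirac_add hf hconv β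
  rw [h.expTilt_eq] at htilt ⊢
  have heq := eqOn_of_convExp_eq_dirac_add (h.exp_mul β).nonneg (h.exp_mul β).integrable
    (h.exp_mul β).memLp_two (by fun_prop) (hf₀.mono fun y hy => mul_nonneg (Real.exp_pos _).le hy)
    htilt isOpen_Ioi (fun y (hy : 1 < y) => (h.exp_mul β).eq_zero y fun hy' => hy.not_ge hy'.2)
    (by fun_prop) hx
  simpa only [Complex.ofReal_re, Complex.re_ofReal_mul] using congrArg Complex.re heq

end IsUnitLevyDensity

end TiltedInversion

section LevyCumulant

variable {g : ℝ → ℝ}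

/-- The Lévy measure `g(x) dx` on `[0, 1]`. -/
noncomputable abbrev levyMeasure (g : ℝ → ℝ) : Measure ℝ :=
  measureOfDensity ((Icc (0 : ℝ) 1).indicator g)

theorem isUnitLevyDensity_indicator (hg₀ : 0 ≤ᵐ[volume.restrict (Icc (0 : ℝ) 1)] g)
    (hg₂ : MemLp g 2 (volume.restrict (Icc (0 : ℝ) 1))) :
    IsUnitLevyDensity ((Icc (0 : ℝ) 1).indicator g) where
  nonneg := by
    filter_upwards [(ae_restrict_iff' measurableSet_Icc).1 hg₀] with x hx
    exact indicator_nonneg (fun _ h => hx h) x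
  memLp_two := (memLp_indicator_iff_restrict measurableSet_Icc).2 hg₂
  eq_zero _ hx := indicator_of_notMem hx g

theorem measureOfDensity_indicator_ne_zero {s : Set ℝ} (hs : MeasurableSet s)
    (hg₀ : 0 ≤ᵐ[volume.restrict s] g) (hg : AEMeasurable g (volume.restrict s))
    (hg_ne : ¬ g =ᵐ[volume.restrict s] 0) : measureOfDensity (s.indicator g) ≠ 0 := by
  intro hzero
  rw [measureOfDensity, withDensity_eq_zero_iff
    ((aemeasurable_indicator_iff hs).2 hg).ennreal_ofReal] at hzero
  refine hg_ne ?_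
  filter_upwards [ae_restrict_of_ae hzero, hg₀, ae_restrict_mem hs] with x hx hx₀ hxs
  rw [indicator_of_mem hxs, Pi.zero_apply, ENNReal.ofReal_eq_zero] at hx
  exact hx.antisymm hx₀

theorem levyCumulant_eq_integral_indicator (g : ℝ → ℝ) (θ : ℝ) : levyCumulant g θ =
    ∫ x, (Icc (0 : ℝ) 1).indicator g x * (Real.exp (θ * x) - 1) := by
  rw [levyCumulant, intervalIntegral.integral_of_le zero_le_one, ← integral_Icc_eq_integral_Ioc,
    ← integral_indicator measurableSet_Icc]
  exact integral_congr_ae (.of_forall fun x => by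
    simp only [mul_comm _ (g _), indicator_mul_left])

variable (h : IsUnitLevyDensity ((Icc (0 : ℝ) 1).indicator g))
include h

theorem levyCumulant_eq_moment_sub (θ : ℝ) :
    levyCumulant g θ = moment id 0 (expTilt θ (levyMeasure g)) - moment id 0 (levyMeasure g) := by
  have := h.isFiniteMeasure
  have hint := integrable_pow_mul_exp h.ae_mem_Icc 0 θ
  rw [levyCumulant_eq_integral_indicator, moment_id_expTilt, moment_id_eq_integral,
    ← integral_sub hint (integrable_pow h.ae_mem_Icc 0),
    integral_measureOfDensity h.integrable.aemeasurable h.nonneg]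
  simp only [smul_eq_mul, pow_zero, one_mul]

theorem deriv_levyCumulant :
    deriv (levyCumulant g) = fun θ => moment id 1 (expTilt θ (levyMeasure g)) := by
  have := h.isFiniteMeasure
  rw [funext (levyCumulant_eq_moment_sub h)]
  exact funext fun θ => ((hasDerivAt_moment_id_expTilt h.ae_mem_Icc 0 θ).sub_const _).deriv

theorem tiltedSigma_eq_sqrt_moment (θ : ℝ) :
    tiltedSigma g θ = √(moment id 2 (expTilt θ (levyMeasure g))) := by
  have := h.isFiniteMeasure
  rw [tiltedSigma, iteratedDeriv_succ, iteratedDeriv_one, deriv_levyCumulant h,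
    (hasDerivAt_moment_id_expTilt h.ae_mem_Icc 1 θ).deriv]

variable {Ω : Type*} [MeasurableSpace Ω] {T : Ω → ℝ} {P : Measure Ω} [IsProbabilityMeasure P]

theorem HasLevyDensity.map_eq (hTg : HasLevyDensity T P g) (hT : AEMeasurable T P) :
    P.map T =
      ENNReal.ofReal (Real.exp (-moment id 0 (levyMeasure g))) • convExp (levyMeasure g) := by
  have := h.isFiniteMeasure
  have : IsProbabilityMeasure (P.map T) := Measure.isProbabilityMeasure_map hT
  rw [moment_id_zero]
  refine eq_smul_convExp_of_mgf_id_eq (fun θ => isFiniteMeasure_expTilt h.ae_mem_Icc θ)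
    fun θ => ?_
  rw [mgf_id_map hT, ← exp_cgf (hTg θ).1, (hTg θ).2, levyCumulant_eq_moment_sub h, moment_id_zero,
    moment_id_zero]

theorem HasLevyDensity.exists_isDefectiveDensity (hTg : HasLevyDensity T P g)
    (hT : AEMeasurable T P) : ∃ f : ℝ → ℝ, IsDefectiveDensity T P f := by
  have := h.isFiniteMeasure
  obtain ⟨f, hf, hf₀, hfc, hconv⟩ := exists_convExp_eq_dirac_add_measureOfDensity h.nonneg
    h.integrable h.memLp_two measurableSet_Ioi fun x (hx : 1 < x) =>
      h.eq_zero x fun hx' => hx.not_ge hx'.2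
  exact ⟨_, isDefectiveDensity_const_mul (measureOfDensity_absolutelyContinuous _)
    (Real.exp_pos _).le (hTg.map_eq h hT) hf hf₀ hfc hconv⟩

theorem HasLevyDensity.density_eq_saddleTerm_mul (hTg : HasLevyDensity T P g)
    (hT : AEMeasurable T P) {f : ℝ → ℝ} (hf : IsDefectiveDensity T P f) {β u v : ℝ}
    (hu : moment id 1 (expTilt β (levyMeasure g)) = u)
    (hs : 0 < moment id 2 (expTilt β (levyMeasure g))) (huv : 1 < u + v) :
    f (u + v) = saddleTerm g β u *
      (Real.exp (-(β * v)) * (saddleRatio (expTilt β (levyMeasure g)) v).re) := by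
  have := h.isFiniteMeasure
  have htilt := h.exp_mul_density_eq (hf.measurable.const_mul _).aemeasurable
    (.of_forall fun x => mul_nonneg (by positivity) (hf.nonneg x)) (hf.continuousOn.const_mul _)
    (hf.convExp_eq_dirac_add (measureOfDensity_absolutelyContinuous _) (Real.exp_pos _)
      (hTg.map_eq h hT)) β huv
  rw [saddleTerm, levyCumulant_eq_moment_sub h, tiltedSigma_eq_sqrt_moment h, saddleRatio, hu,
    Complex.re_ofReal_mul, Real.sqrt_div' _ (by positivity)]
  set m := moment id 0 (expTilt β (levyMeasure g))
  set Λ := moment id 0 (levyMeasure g)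
  have hexp : Real.exp (m - Λ - u * β) * Real.exp (-(β * v)) * Real.exp (-m) =
      Real.exp (-Λ) / Real.exp (β * (u + v)) := by
    rw [← Real.exp_add, ← Real.exp_add, ← Real.exp_sub]
    ring_nf
  have hπ : √(2 * Real.pi) ^ 2 = 2 * Real.pi := Real.sq_sqrt (by positivity)
  have hσ : √(moment id 2 (expTilt β (levyMeasure g))) ≠ 0 := (Real.sqrt_pos.2 hs).ne'
  calc f (u + v) = Real.exp (-Λ) / Real.exp (β * (u + v)) *
        (Real.exp (β * (u + v)) * ((Real.exp (-Λ))⁻¹ * f (u + v))) := by field_simp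
    _ = Real.exp (m - Λ - u * β) * Real.exp (-(β * v)) * Real.exp (-m) *
        ((√(2 * Real.pi) ^ 2)⁻¹ *
          (poissonInversion (expTilt β (levyMeasure g)) (u + v)).re) := by rw [htilt, hexp, hπ]
    _ = _ := by field_simp

end LevyCumulant

section SaddlePoint

theorem isBigO_one_div_one_div_sqrt :
    (fun u : ℝ => 1 / u) =O[atTop] fun u => 1 / √u := by
  refine .of_bound' ?_
  filter_upwards [eventually_ge_atTop 1] with u hu
  rw [Real.norm_of_nonneg (by positivity), Real.norm_of_nonneg (by positivity)]
  gcongr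
  exact Real.sqrt_le_self_iff.2 (.inr hu)

theorem tendsto_one_div_sqrt_atTop : Tendsto (fun u : ℝ => 1 / √u) atTop (𝓝 0) := by
  simpa only [one_div, Function.comp_def] using
    tendsto_inv_atTop_zero.comp Real.tendsto_sqrt_atTop

section Mean

variable {ν : Measure ℝ} [IsFiniteMeasure ν] {β : ℝ → ℝ} {a : ℝ}

theorem tendsto_atTop_of_moment_one_expTilt_eq (hν : ∀ᵐ x ∂ν, x ∈ Icc (0 : ℝ) 1) (ha : 0 < a)
    (hνa : ν (Ici a) ≠ 0) (hβ : ∀ u, 0 < u → moment id 1 (expTilt (β u) ν) = u) :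
    Tendsto β atTop atTop := by
  refine tendsto_atTop.2 fun b => ?_
  filter_upwards [eventually_gt_atTop 0, eventually_ge_atTop (moment id 1 (expTilt b ν))]
    with u hu hub
  rw [← hβ u hu] at hub
  exact (strictMono_moment_id_expTilt hν ha hνa 1).le_iff_le.1 hub

theorem isBigO_one_div_moment_two_expTilt (hν : ∀ᵐ x ∂ν, x ∈ Icc (0 : ℝ) 1) (ha : 0 < a)
    (hνa : ν (Ici a) ≠ 0) (hβ : ∀ u, 0 < u → moment id 1 (expTilt (β u) ν) = u) :
    (fun u => 1 / moment id 2 (expTilt (β u) ν)) =O[atTop] fun u => 1 / u := by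
  refine .of_bound (4 / a) ?_
  filter_upwards [(tendsto_atTop_of_moment_one_expTilt_eq hν ha hνa hβ).eventually
    (eventually_mul_moment_one_le_moment_two_expTilt hν ha hνa), eventually_gt_atTop 0] with u h hu
  rw [hβ u hu] at h
  have hau : 0 < a / 4 * u := by positivity
  rw [Real.norm_of_nonneg (one_div_nonneg.2 (hau.le.trans h)), Real.norm_of_nonneg (by positivity)]
  calc 1 / moment id 2 (expTilt (β u) ν) ≤ 1 / (a / 4 * u) := one_div_le_one_div_of_le hau h
    _ = 4 / a * (1 / u) := by field_simp

theorem isBigO_one_div_sqrt_moment_two_expTilt (hν : ∀ᵐ x ∂ν, x ∈ Icc (0 : ℝ) 1) (ha : 0 < a)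
    (hνa : ν (Ici a) ≠ 0) (hβ : ∀ u, 0 < u → moment id 1 (expTilt (β u) ν) = u) :
    (fun u => 1 / √(moment id 2 (expTilt (β u) ν))) =O[atTop] fun u => 1 / √u := by
  have hsqrt := (isBigO_one_div_moment_two_expTilt hν ha hνa hβ).sqrt
    ((eventually_ge_atTop 0).mono fun u hu => one_div_nonneg.2 hu)
  simpa only [Real.sqrt_div zero_le_one, Real.sqrt_one] using hsqrt

end Mean

variable {Ω : Type*} [MeasurableSpace Ω] {T : Ω → ℝ} {P : Measure Ω} [IsProbabilityMeasure P]
  {g f β : ℝ → ℝ}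

theorem HasLevyDensity.eqMulOneAddBigO_density (hTg : HasLevyDensity T P g)
    (hT : AEMeasurable T P) (h : IsUnitLevyDensity ((Icc (0 : ℝ) 1).indicator g))
    (hg : levyMeasure g ≠ 0) (hf : IsDefectiveDensity T P f)
    (hβ : ∀ u, 0 < u → moment id 1 (expTilt (β u) (levyMeasure g)) = u) :
    EqMulOneAddBigO f (fun u => saddleTerm g (β u) u) (fun u => 1 / u) := by
  have := h.isFiniteMeasure
  obtain ⟨a, ha, hga⟩ := h.exists_Ici_ne_zero hg
  have hβ_atTop := tendsto_atTop_of_moment_one_expTilt_eq h.ae_mem_Icc ha hga hβ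
  refine ⟨fun u => (saddleRatio (expTilt (β u) (levyMeasure g)) 0).re - 1, ?_, ?_⟩
  · refine IsBigO.trans (.of_bound 18601 ?_)
      (isBigO_one_div_moment_two_expTilt h.ae_mem_Icc ha hga hβ)
    filter_upwards [hβ_atTop.eventually (h.eventually_norm_saddleRatio_sub_one_le hg)] with u hu
    have hs := moment_id_expTilt_pos h.ae_mem_Icc ha hga 2 (β u)
    rw [Real.norm_of_nonneg (one_div_nonneg.2 hs.le), mul_one_div]
    simpa using (Complex.abs_re_le_norm _).trans (hu 0 le_rfl)
  · filter_upwards [eventually_gt_atTop 1] with u hu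
    simpa using hTg.density_eq_saddleTerm_mul h hT hf (hβ u (one_pos.trans hu))
      (moment_id_expTilt_pos h.ae_mem_Icc ha hga 2 (β u)) (v := 0) (by simpa using hu)

theorem HasLevyDensity.measureReal_eq_saddleTerm_mul (hTg : HasLevyDensity T P g)
    (hT : AEMeasurable T P) (h : IsUnitLevyDensity ((Icc (0 : ℝ) 1).indicator g))
    (hf : IsDefectiveDensity T P f) {β u : ℝ} (hu₁ : 1 ≤ u)
    (hu : moment id 1 (expTilt β (levyMeasure g)) = u)
    (hs : 0 < moment id 2 (expTilt β (levyMeasure g))) :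
    P.real {ω | u ≤ T ω} = saddleTerm g β u *
      ∫ v in Ioi 0, Real.exp (-(β * v)) * (saddleRatio (expTilt β (levyMeasure g)) v).re := by
  rw [hf.measureReal_Ici hT (one_pos.trans_le hu₁), ← integral_const_mul]
  refine setIntegral_congr_fun measurableSet_Ioi fun v hv => ?_
  exact hTg.density_eq_saddleTerm_mul h hT hf hu hs (lt_add_of_le_of_pos hu₁ hv)

theorem IsUnitLevyDensity.eventually_abs_mul_integral_sub_one_le {k : ℝ → ℝ}
    (h : IsUnitLevyDensity k) (hk : measureOfDensity k ≠ 0) :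
    ∀ᶠ β in atTop, |β * (∫ v in Ioi 0, Real.exp (-(β * v)) *
        (saddleRatio (expTilt β (measureOfDensity k)) v).re) - 1| ≤
      6 / √(moment id 2 (expTilt β (measureOfDensity k))) +
        18601 / moment id 2 (expTilt β (measureOfDensity k)) := by
  have := h.isFiniteMeasure
  obtain ⟨a, ha, hka⟩ := h.exists_Ici_ne_zero hk
  filter_upwards [h.eventually_norm_saddleRatio_sub_one_le hk, eventually_ge_atTop 1] with β hβ hβ₁
  have := isFiniteMeasure_expTilt h.ae_mem_Icc β
  have hβ₀ := one_pos.trans_le hβ₁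
  have hs := moment_id_expTilt_pos h.ae_mem_Icc ha hka 2 β
  set s := moment id 2 (expTilt β (measureOfDensity k))
  have hle := abs_integral_exp_neg_mul_mul_sub_inv_le hβ₀ (b := 6 / √s) (c := 18601 / s)
    (Complex.continuous_re.comp (continuous_saddleRatio
      (h.integrable_sq_norm_charFun_expTilt β))).aestronglyMeasurable
    fun v hv => by
      rw [div_mul_eq_mul_div]
      exact (Complex.abs_re_le_norm (saddleRatio _ v - 1)).trans (hβ v (le_of_lt hv))
  simp only [Function.comp_apply] at hle
  set I := ∫ v in Ioi 0, Real.exp (-(β * v)) *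
    (saddleRatio (expTilt β (measureOfDensity k)) v).re
  calc |β * I - 1| = β * |I - β⁻¹| := by
        rw [← abs_of_pos hβ₀, ← abs_mul, abs_of_pos hβ₀, mul_sub, mul_inv_cancel₀ hβ₀.ne']
    _ ≤ β * (6 / √s / β ^ 2 + 18601 / s / β) := by gcongr
    _ = 6 / √s / β + 18601 / s := by field_simp
    _ ≤ 6 / √s + 18601 / s := by
        gcongr ?_ + _; exact div_le_self (by positivity) hβ₁

theorem HasLevyDensity.eqMulOneAddBigO_measureReal (hTg : HasLevyDensity T P g)
    (hT : AEMeasurable T P) (h : IsUnitLevyDensity ((Icc (0 : ℝ) 1).indicator g))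
    (hg : levyMeasure g ≠ 0) (hf : IsDefectiveDensity T P f)
    (hβ : ∀ u, 0 < u → moment id 1 (expTilt (β u) (levyMeasure g)) = u) :
    EqMulOneAddBigO (fun u => P.real {ω | u ≤ T ω})
      (fun u => 1 / β u * saddleTerm g (β u) u) (fun u => 1 / √u) := by
  have := h.isFiniteMeasure
  obtain ⟨a, ha, hga⟩ := h.exists_Ici_ne_zero hg
  have hβ_atTop := tendsto_atTop_of_moment_one_expTilt_eq h.ae_mem_Icc ha hga hβ
  refine ⟨fun u => β u * (∫ v in Ioi 0, Real.exp (-(β u * v)) *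
    (saddleRatio (expTilt (β u) (levyMeasure g)) v).re) - 1, ?_, ?_⟩
  · have hle := hβ_atTop.eventually (h.eventually_abs_mul_integral_sub_one_le hg)
    simp only [div_eq_mul_one_div (6 : ℝ), div_eq_mul_one_div (18601 : ℝ)] at hle
    refine IsBigO.trans (.of_norm_eventuallyLE hle) ?_
    exact .add (.const_mul_left (isBigO_one_div_sqrt_moment_two_expTilt h.ae_mem_Icc ha hga hβ) _)
      (.const_mul_left ((isBigO_one_div_moment_two_expTilt h.ae_mem_Icc ha hga hβ).trans
        isBigO_one_div_one_div_sqrt) _)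
  · filter_upwards [eventually_ge_atTop 1, hβ_atTop.eventually_gt_atTop 0] with u hu hβ₀
    rw [hTg.measureReal_eq_saddleTerm_mul hT h hf hu (hβ u (one_pos.trans_le hu))
      (moment_id_expTilt_pos h.ae_mem_Icc ha hga 2 (β u)), add_sub_cancel, one_div,
      mul_comm (β u)⁻¹, mul_assoc, inv_mul_cancel_left₀ hβ₀.ne']

end SaddlePoint

section PiecewiseContDiff

theorem exists_mem_Ioo_of_notMem_range {α : Type*} [LinearOrder α] {n : ℕ} {p : Fin (n + 1) → α}
    {x : α} (h₀ : p 0 < x) (h₁ : x < p (Fin.last n)) (hx : x ∉ range p) :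
    ∃ i : Fin n, x ∈ Ioo (p i.castSucc) (p i.succ) := by
  by_contra! hne
  have hlt (i : Fin (n + 1)) : p i < x := by
    induction i using Fin.induction with
    | zero => exact h₀
    | succ i ih => exact (not_lt.1 fun hlt => hne i ⟨ih, hlt⟩).lt_of_ne fun he => hx ⟨_, he⟩
  exact (hlt (Fin.last n)).not_gt h₁

theorem exists_norm_le_on_Ioo {E : Type*} [NormedAddCommGroup E] {g : ℝ → E} {a b : ℝ} {l l' : E}
    (hc : ContinuousOn g (Ioo a b)) (ha : Tendsto g (𝓝[>] a) (𝓝 l))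
    (hb : Tendsto g (𝓝[<] b) (𝓝 l')) : ∃ C, ∀ x ∈ Ioo a b, ‖g x‖ ≤ C := by
  obtain ⟨C, hC⟩ := isCompact_Icc.exists_bound_of_continuousOn
    (continuousOn_Icc_extendFrom_Ioo hc ha hb)
  refine ⟨C, fun x hx => ?_⟩
  rw [← extendFrom_eq (subset_closure hx) (hc x hx)]
  exact hC x (Ioo_subset_Icc_self hx)

theorem PiecewiseContDiff.memLp {k : ℕ} {g : ℝ → ℝ} {a b : ℝ} (hg : PiecewiseContDiff k g a b)
    (q : ENNReal) : MemLp g q (volume.restrict (Icc a b)) := by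
  obtain ⟨n, p, -, rfl, rfl, hp⟩ := hg
  rw [← restrict_Ioo_eq_restrict_Icc]
  have hcover : Ioo (p 0) (p (Fin.last n)) ≤ᵐ[volume]
      ⋃ i : Fin n, Ioo (p i.castSucc) (p i.succ) := by
    filter_upwards [measure_eq_zero_iff_ae_notMem.1 ((finite_range p).measure_zero volume)]
      with x hxp hx
    exact mem_iUnion.2 (exists_mem_Ioo_of_notMem_range hx.1 hx.2 hxp)
  have hbound (i : Fin n) : ∃ C, ∀ x ∈ Ioo (p i.castSucc) (p i.succ), ‖g x‖ ≤ C := by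
    obtain ⟨⟨l, hl⟩, ⟨l', hl'⟩⟩ := (hp i).2 0 (Nat.zero_le _)
    rw [iteratedDeriv_zero] at hl hl'
    exact exists_norm_le_on_Ioo (hp i).1.continuousOn hl hl'
  choose C hC using hbound
  obtain ⟨B, hB⟩ := (finite_range C).bddAbove
  have hmeas : AEStronglyMeasurable g
      (volume.restrict (⋃ i : Fin n, Ioo (p i.castSucc) (p i.succ))) :=
    aestronglyMeasurable_iUnion_iff.2 fun i =>
      (hp i).1.continuousOn.aestronglyMeasurable measurableSet_Ioo
  refine .of_bound (hmeas.mono_measure (Measure.restrict_mono_ae hcover)) B ?_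
  filter_upwards [ae_restrict_mem measurableSet_Ioo, ae_restrict_of_ae hcover] with x hx hx_cover
  obtain ⟨i, hi⟩ := mem_iUnion.1 (hx_cover hx)
  exact (hC i x hi).trans (hB ⟨i, rfl⟩)

theorem not_ae_eq_zero_of_forall_le {g : ℝ → ℝ} {ε : ℝ} (hε : 0 < ε)
    (hg : ∀ x ∈ Icc (0 : ℝ) 1, 1 - ε ≤ x → ε ≤ g x) :
    ¬ g =ᵐ[volume.restrict (Icc (0 : ℝ) 1)] 0 := by
  intro hzero
  have hsubset : Ioo (max 0 (1 - ε)) 1 ⊆ {x | ¬ (x ∈ Icc (0 : ℝ) 1 → g x = 0)} := by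
    intro x ⟨hx, hx₁⟩ hgx
    obtain ⟨hx₀, hxε⟩ := max_lt_iff.1 hx
    have hmem : x ∈ Icc (0 : ℝ) 1 := ⟨hx₀.le, hx₁.le⟩
    exact (hε.trans_le (hg x hmem hxε.le)).ne' (hgx hmem)
  have hnull := measure_mono_null hsubset ((ae_restrict_iff' measurableSet_Icc).1 hzero)
  rw [Real.volume_Ioo, ENNReal.ofReal_eq_zero, sub_nonpos, le_max_iff] at hnull
  rcases hnull with h | h <;> linarith

end PiecewiseContDiff

theorem mainTheorem2_general {Ω : Type*} [MeasurableSpace Ω] (P : Measure Ω)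
    [IsProbabilityMeasure P] (T : Ω → ℝ) (hT : AEMeasurable T P)
    (g : ℝ → ℝ) (hg_nonneg : 0 ≤ᵐ[volume.restrict (Icc (0 : ℝ) 1)] g)
    (hg_sq : MemLp g 2 (volume.restrict (Icc (0 : ℝ) 1)))
    (hg_ne : ¬ g =ᵐ[volume.restrict (Icc (0 : ℝ) 1)] 0)
    (hTg : HasLevyDensity T P g) :
    (∃ f : ℝ → ℝ, IsDefectiveDensity T P f) ∧
    (∀ u : ℝ, 0 < u → ∃! b : ℝ, deriv (levyCumulant g) b = u) ∧
    ∀ f : ℝ → ℝ, IsDefectiveDensity T P f →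
    ∀ β : ℝ → ℝ, (∀ u : ℝ, 0 < u → deriv (levyCumulant g) (β u) = u) →
      EqMulOneAddBigO f (fun u => saddleTerm g (β u) u) (fun u => 1 / u) ∧
      EqMulOneAddBigO (fun u => P.real {ω | u ≤ T ω})
        (fun u => 1 / β u * saddleTerm g (β u) u) (fun u => 1 / Real.sqrt u) ∧
      EqMulOneAddBigO (fun u => P.real {ω | u ≤ T ω})
        (fun u => f u / β u) (fun u => 1 / Real.sqrt u) := by
  have h := isUnitLevyDensity_indicator hg_nonneg hg_sq
  have hg := measureOfDensity_indicator_ne_zero measurableSet_Icc hg_nonneg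
    hg_sq.1.aemeasurable hg_ne
  have := h.isFiniteMeasure
  obtain ⟨a, ha, hga⟩ := h.exists_Ici_ne_zero hg
  rw [deriv_levyCumulant h]
  refine ⟨hTg.exists_isDefectiveDensity h hT,
    fun u hu => existsUnique_moment_id_succ_expTilt_eq h.ae_mem_Icc ha hga 0 hu,
    fun f hf β hβ => ?_⟩
  have hdensity := hTg.eqMulOneAddBigO_density hT h hg hf hβ
  have htail := hTg.eqMulOneAddBigO_measureReal hT h hg hf hβ
  have hdensity_div := (hdensity.trans_isBigO isBigO_one_div_one_div_sqrt).mul_left (1 / β ·)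
  refine ⟨hdensity, htail, ?_⟩
  simpa only [one_div_mul_eq_div] using
    htail.of_common_main_term hdensity_div tendsto_one_div_sqrt_atTop

theorem mainTheorem2 {Ω : Type*} [MeasurableSpace Ω] (P : Measure Ω) [IsProbabilityMeasure P]
    (T : Ω → ℝ) (hT : AEMeasurable T P)
    (g : ℝ → ℝ) (hg_nonneg : ∀ x ∈ Icc (0 : ℝ) 1, 0 ≤ g x)
    (hg_smooth : PiecewiseContDiff 2 g 0 1)
    (ε : ℝ) (hε : 0 < ε) (hg_lower : ∀ x ∈ Icc (0 : ℝ) 1, 1 - ε ≤ x → ε ≤ g x)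
    (hTg : HasLevyDensity T P g) :
    (∃ f : ℝ → ℝ, IsDefectiveDensity T P f) ∧
    (∀ u : ℝ, 0 < u → ∃! b : ℝ, deriv (levyCumulant g) b = u) ∧
    ∀ f : ℝ → ℝ, IsDefectiveDensity T P f →
    ∀ β : ℝ → ℝ, (∀ u : ℝ, 0 < u → deriv (levyCumulant g) (β u) = u) →
      EqMulOneAddBigO f (fun u => saddleTerm g (β u) u) (fun u => 1 / u) ∧
      EqMulOneAddBigO (fun u => P.real {ω | u ≤ T ω})
        (fun u => 1 / β u * saddleTerm g (β u) u) (fun u => 1 / Real.sqrt u) ∧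
      EqMulOneAddBigO (fun u => P.real {ω | u ≤ T ω})
        (fun u => f u / β u) (fun u => 1 / Real.sqrt u) :=
  mainTheorem2_general P T hT g (ae_restrict_of_forall_mem measurableSet_Icc hg_nonneg)
    (hg_smooth.memLp 2) (not_ae_eq_zero_of_forall_le hε hg_lower) hTg
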